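/- Let $K$ be a field of characteristic zero and let $\alpha\in K$ be neither zero nor a negative rational number (for example $K=\mathbb R$, $\alpha>0$). Let $N\ge 0$, let $\eta=(\eta_1,\dots,\eta_N)$ be a composition with non-negative integer parts, let $\eta^+=(\eta^+_1\ge\dots\ge\eta^+_N)$ be its parts in weakly decreasing order and $\eta^R:=(\eta^+_N,\dots,\eta^+_1)$, and let $f_j$ be the number of parts of $\eta^+$ equal to $j$. The symmetric Jack polynomial $P_\kappa^{(\alpha)}$ of a partition $\kappa$ of length at most $N$ is the unique symmetric polynomial in $z_1,\dots,z_N$ of the form $m_\kappa+\sum_{\mu<\kappa}u_{\kappa\mu}m_\mu$ (with $m_\mu$ the monomial symmetric functions and $<$ the strict dominance order on partitions of the same size) that is an eigenfunction of $$D_2(\alpha)=\sum_{j=1}^N z_j^2\frac{\partial^2}{\partial z_j^2}+\frac{2}{\alpha}\sum_{j\ne k}\frac{z_j^2}{z_j-z_k}\frac{\partial}{\partial z_j}.$$ For a composition $\nu$ with $N$ parts and a node $s=(i,j)$ of its diagram ($1\le i\le N$, $1\le j\le\nu_i$) put $$a(s)=\nu_i-j,\qquad l(s)=\#\{k>i: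 j\le\nu_k\le\nu_i\}+\#\{k<i: j\le\nu_k+1\le\nu_i\},$$ $$a'(s)=j-1,\qquad l'(s)=\#\{k>i:\nu_k>\nu_i\}+\#\{k<i:\nu_k\ge\nu_i\},$$ and define $$d_\nu=\prod_{s\in\nu}(\alpha(a(s)+1)+l(s)+1),\qquad e_\nu=\prod_{s\in\nu}(\alpha(a'(s)+1)+N-l'(s)),$$ $$b_\nu=\prod_{s\in\nu}(\alpha a'(s)+N-l'(s)),\qquad h_\nu=\prod_{s\in\nu}(\alpha a(s)+l(s)+1).$$ Then $P_{\eta^+}^{(\alpha)}$ exists and is unique, and its value at $z_1=\dots=z_N=1$ is $$P_{\eta^+}^{(\alpha)}(1^N)=\frac{N!}{\prod_{j\ge 0}f_j!}\,\frac{e_{\eta^R}}{d_{\eta^R}}=\frac{b_{\eta^+}}{h_{\eta^+}}.$$ -/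

import Mathlib

/-! Compositions with `N` parts are functions `η : Fin N → ℕ`; partitions of length at most `N`
are the antitone ones.  The rows of a diagram are indexed by `i : Fin N`, the columns by
`j ∈ {1, …, η i}`. -/

namespace Jack

section Diagrams

variable {N : ℕ}

/-- The partition `η⁺`: the parts of `η` in weakly decreasing order. -/
def plus (η : Fin N → ℕ) : Fin N → ℕ := fun i => η (Tuple.sort η (Fin.rev i))

/-- The composition `ηᴿ = (η⁺_N, …, η⁺_1)`. -/
def rev (η : Fin N → ℕ) : Fin N → ℕ := fun i => plus η (Fin.rev i)

/-- The number `f_j` of parts of `η` that are equal to `j`. -/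
def freq (η : Fin N → ℕ) (j : ℕ) : ℕ := (Finset.univ.filter fun i => η i = j).card

/-- The arm length `a(s)` of the node `s = (i, j)`. -/
def arm (η : Fin N → ℕ) (i : Fin N) (j : ℕ) : ℕ := η i - j

/-- The arm colength `a'(s)` of the node `s = (i, j)`. -/
def coarm (j : ℕ) : ℕ := j - 1

/-- The leg length `l(s)` of the node `s = (i, j)`. -/
def leg (η : Fin N → ℕ) (i : Fin N) (j : ℕ) : ℕ :=
  (Finset.univ.filter fun k => i < k ∧ j ≤ η k ∧ η k ≤ η i).card +
  (Finset.univ.filter fun k => k < i ∧ j ≤ η k + 1 ∧ η k + 1 ≤ η i).card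

/-- The leg colength `l'(s)` of a node `s` in row `i`. -/
def coleg (η : Fin N → ℕ) (i : Fin N) : ℕ :=
  (Finset.univ.filter fun k => i < k ∧ η i < η k).card +
  (Finset.univ.filter fun k => k < i ∧ η i ≤ η k).card

variable {K : Type*} [Field K]

/-- `d_η = ∏_s (α (a(s) + 1) + l(s) + 1)`. -/
def d (α : K) (η : Fin N → ℕ) : K :=
  ∏ i, ∏ j ∈ Finset.Icc 1 (η i), (α * ((arm η i j : K) + 1) + (leg η i j : K) + 1)

/-- `e_η = ∏_s (α (a'(s) + 1) + N - l'(s))`. -/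
def e (α : K) (η : Fin N → ℕ) : K :=
  ∏ i, ∏ j ∈ Finset.Icc 1 (η i), (α * ((coarm j : K) + 1) + (N : K) - (coleg η i : K))

/-- `b_η = ∏_s (α a'(s) + N - l'(s))`. -/
def b (α : K) (η : Fin N → ℕ) : K :=
  ∏ i, ∏ j ∈ Finset.Icc 1 (η i), (α * (coarm j : K) + (N : K) - (coleg η i : K))

/-- `h_η = ∏_s (α a(s) + l(s) + 1)`. -/
def h (α : K) (η : Fin N → ℕ) : K :=
  ∏ i, ∏ j ∈ Finset.Icc 1 (η i), (α * (arm η i j : K) + (leg η i j : K) + 1)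

end Diagrams

section Polynomials

variable {N : ℕ}

/-- Strict dominance order `μ < κ` between sequences of the same modulus. -/
def DomLT (μ κ : Fin N → ℕ) : Prop :=
  μ ≠ κ ∧ ∑ i, μ i = ∑ i, κ i ∧ ∀ p : Fin N, ∑ i ∈ Finset.Iic p, μ i ≤ ∑ i ∈ Finset.Iic p, κ i

variable {K : Type*} [Field K]

variable (K) in
/-- The monomial symmetric function `m_μ(z_1, …, z_N)`. -/
noncomputable def monomialSymm (μ : Fin N → ℕ) : MvPolynomial (Fin N) K :=
  MvPolynomial.msymm (Fin N) K (Nat.Partition.ofMultiset (Finset.univ.val.map μ))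

/-- The differential operator
`D₂(α) = ∑_j z_j² ∂_j² + (2/α) ∑_{j ≠ k} z_j² / (z_j - z_k) ∂_j`,
applied to a polynomial, with values in the field of rational functions. -/
noncomputable def D₂ (α : K) (P : MvPolynomial (Fin N) K) :
    FractionRing (MvPolynomial (Fin N) K) :=
  let ι := algebraMap (MvPolynomial (Fin N) K) (FractionRing (MvPolynomial (Fin N) K))
  ∑ j, ι (MvPolynomial.X j ^ 2 * MvPolynomial.pderiv j (MvPolynomial.pderiv j P)) +
  ι (MvPolynomial.C (2 / α)) * ∑ j, ∑ k ∈ Finset.univ.erase j,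
    ι (MvPolynomial.X j ^ 2) / ι (MvPolynomial.X j - MvPolynomial.X k) *
      ι (MvPolynomial.pderiv j P)

/-- `P` is the symmetric Jack polynomial `P_κ^{(α)}`: a symmetric polynomial eigenfunction of
`D₂(α)` of the form `m_κ + ∑_{μ < κ} u_{κμ} m_μ`, the sum being over partitions `μ`. -/
def IsSymmetricJack (α : K) (κ : Fin N → ℕ) (P : MvPolynomial (Fin N) K) : Prop :=
  P.IsSymmetric ∧
  (∃ c : K, D₂ α P = algebraMap (MvPolynomial (Fin N) K) _ (MvPolynomial.C c * P)) ∧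
  P - monomialSymm K κ ∈
    Submodule.span K {m | ∃ μ : Fin N → ℕ, Antitone μ ∧ DomLT μ κ ∧ m = monomialSymm K μ}

end Polynomials

end Jack

/-! The symmetric Jack polynomial is the symmetrization of a nonsymmetric one, whose value at `(1,
…, 1)` can be followed through a recursion. The nonsymmetric Jack polynomial `E_η` is a joint
eigenvector of the Cherednik operators `ξ_i`, with eigenvalues `α η_i - l'_i` and coefficient 1 at
`z^η`. All of them arise from `E_0 = 1` by two moves. The raising operator permutes the `ξ_i`
cyclically up to a shift by `α`, so it takes `E_η` to the polynomial of `(η_2, …, η_N, η_1 + 1)`. If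
`s` exchanges the positions `i`, `i + 1` and `η_i < η_{i+1}`, the relation `s ξ_i = ξ_{i+1} s + 1`
makes `s E_η + δ⁻¹ E_η` the polynomial of `s η`, where `δ` is the difference of the two eigenvalues.
The first move keeps the value at `(1, …, 1)`, the second multiplies it by `1 + δ⁻¹`. The quotient
`e_η / d_η` changes in the same way (`d_raise`, `e_raise`, `d_comp_swap`, `e_comp_swap`), hence
`E_η(1, …, 1) = e_η / d_η` (`exists_isNonsymmetricJack`). As eigenvectors are constructed
explicitly, the commutativity of the `ξ_i` is never needed.

To pass to symmetric polynomials, `∑ ξ_i²` commutes with all permutations, and on symmetric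
polynomials it is `α² D₂` plus a multiple of the Euler operator plus a constant
(`algebraMap_cherednikSq`). So the symmetrization of `E_ρ`, with `ρ = ηᴿ`, is an eigenfunction of
`D₂`. The `ξ_i` are triangular for an order in which `ρ` is minimal among its rearrangements, so `ρ`
is the only rearrangement of `η⁺` occurring in `E_ρ`. The coefficient of `m_{η⁺}` in the
symmetrization is therefore the order `∏ f_j!` of the stabilizer, and dividing by it gives `P_{η⁺}`
with value `N! / ∏ f_j! * e / d`. Uniqueness holds because the eigenvalues belonging to `κ` and to a
partition `μ < κ` differ. The hypothesis on `α` enters through the nonvanishing of `α m + n` for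
natural numbers `m`, `n` that are not both zero.

The second formula is combinatorial: row by row, the products for `e` and `b`, and those for `d` and
`h`, differ only in their end factors (`factorial_mul_e`, `h_mul_prod`). -/

namespace Jack

open MvPolynomial

/-! ### Divided differences -/

section DividedDifference

variable {σ K : Type*} [Field K]

theorem X_sub_X_ne_zero {i j : σ} (h : i ≠ j) : (X i - X j : MvPolynomial σ K) ≠ 0 :=
  sub_ne_zero.2 fun e => h (X_injective e)

theorem rename_pderiv (g : Equiv.Perm σ) (i : σ) (f : MvPolynomial σ K) :
    rename g (pderiv i f) = pderiv (g i) (rename g f) := (pderiv_rename g.injective i f).symm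

variable [DecidableEq σ]

/-- By the twisted Leibniz rule `f g - s(f g) = (f - s f) g + s f (g - s g)` it is enough to check
constants and single variables. -/
theorem X_sub_X_dvd_sub_rename_swap (i j : σ) (f : MvPolynomial σ K) :
    X i - X j ∣ f - rename (Equiv.swap i j) f := by
  induction f using MvPolynomial.induction_on with
  | C a => simp
  | add p q hp hq =>
    rw [map_add, add_sub_add_comm]
    exact dvd_add hp hq
  | mul_X p k hp =>
    have key : (X i - X j : MvPolynomial σ K) ∣ X k - X (Equiv.swap i j k) := by
      rcases eq_or_ne k i with rfl | hi
      · simp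
      rcases eq_or_ne k j with rfl | hj
      · rw [Equiv.swap_apply_right, ← neg_sub]
        exact neg_dvd.2 dvd_rfl
      · simp [Equiv.swap_apply_of_ne_of_ne hi hj]
    have e : p * X k - rename (Equiv.swap i j) (p * X k) =
        (p - rename (Equiv.swap i j) p) * X k +
          rename (Equiv.swap i j) p * (X k - X (Equiv.swap i j k)) := by
      rw [map_mul, rename_X]; ring
    rw [e]
    exact dvd_add (hp.mul_right _) (key.mul_left _)

/-- The value of the divided difference `(f - s_{ij} f) / (z_i - z_j)`, and `0` if `i = j`. -/
noncomputable def divDiffFun (i j : σ) (f : MvPolynomial σ K) : MvPolynomial σ K :=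
  if i = j then 0 else (X_sub_X_dvd_sub_rename_swap i j f).choose

theorem mul_divDiffFun (i j : σ) (f : MvPolynomial σ K) :
    (X i - X j) * divDiffFun i j f = f - rename (Equiv.swap i j) f := by
  by_cases h : i = j
  · subst h; simp [divDiffFun]
  · rw [divDiffFun, if_neg h]
    exact (X_sub_X_dvd_sub_rename_swap i j f).choose_spec.symm

theorem divDiffFun_eq {i j : σ} (h : i ≠ j) {f g : MvPolynomial σ K}
    (hg : (X i - X j) * g = f - rename (Equiv.swap i j) f) : divDiffFun i j f = g :=
  mul_left_cancel₀ (X_sub_X_ne_zero h) ((mul_divDiffFun i j f).trans hg.symm)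

/-- The divided difference operator `(1 - s_{ij}) / (z_i - z_j)`. -/
noncomputable def divDiff (i j : σ) : MvPolynomial σ K →ₗ[K] MvPolynomial σ K where
  toFun := divDiffFun i j
  map_add' f g := by
    by_cases h : i = j
    · simp [divDiffFun, h]
    · apply divDiffFun_eq h
      rw [mul_add, mul_divDiffFun, mul_divDiffFun, map_add]; ring
  map_smul' c f := by
    by_cases h : i = j
    · simp [divDiffFun, h]
    · apply divDiffFun_eq h
      rw [RingHom.id_apply, mul_smul_comm, mul_divDiffFun, map_smul, smul_sub]

theorem mul_divDiff (i j : σ) (f : MvPolynomial σ K) :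
    (X i - X j) * divDiff i j f = f - rename (Equiv.swap i j) f := mul_divDiffFun i j f

theorem divDiff_eq {i j : σ} (h : i ≠ j) {f g : MvPolynomial σ K}
    (hg : (X i - X j) * g = f - rename (Equiv.swap i j) f) : divDiff i j f = g :=
  divDiffFun_eq h hg

@[simp]
theorem divDiff_self (i : σ) (f : MvPolynomial σ K) : divDiff i i f = 0 := by
  simp [divDiff, divDiffFun]

theorem divDiff_comm (i j : σ) (f : MvPolynomial σ K) : divDiff i j f = -divDiff j i f := by
  by_cases h : i = j
  · simp [h]
  · apply divDiff_eq h
    have := mul_divDiff j i f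
    rw [Equiv.swap_comm] at this
    rw [← this]; ring

theorem divDiff_eq_zero {i j : σ} {f : MvPolynomial σ K}
    (h : rename (Equiv.swap i j) f = f) : divDiff i j f = 0 := by
  by_cases hij : i = j
  · simp [hij]
  · exact divDiff_eq hij (by simp [h])

theorem rename_divDiff (g : Equiv.Perm σ) (i j : σ) (f : MvPolynomial σ K) :
    rename g (divDiff i j f) = divDiff (g i) (g j) (rename g f) := by
  by_cases h : i = j
  · simp [h]
  · symm
    apply divDiff_eq (g.injective.ne h)
    have := congrArg (rename g) (mul_divDiff i j f)
    rw [map_mul, map_sub, rename_X, rename_X, map_sub, rename_rename] at this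
    rw [this, rename_rename]
    congr 3
    ext x
    simp [Equiv.swap_apply_apply]

end DividedDifference

/-! ### Cherednik operators and their relations with adjacent transpositions -/

section Cherednik

variable {N : ℕ} {K : Type*} [Field K]

/-- The Cherednik operator
`ξ_i = α z_i ∂_i + ∑_{p ≠ i} z_{max i p} (1 - s_{ip}) / (z_i - z_p) - i`, where `i = 0, …, N - 1`. -/
noncomputable def cherednik (α : K) (i : Fin N) :
    MvPolynomial (Fin N) K →ₗ[K] MvPolynomial (Fin N) K where
  toFun f := α • (X i * pderiv i f) + ∑ p, X (max i p) * divDiff i p f - (i : K) • f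
  map_add' f g := by
    simp only [map_add, mul_add, smul_add, Finset.sum_add_distrib]; ring
  map_smul' c f := by
    simp only [map_smul, Derivation.map_smul, mul_smul_comm, RingHom.id_apply, smul_add, smul_sub,
      Finset.smul_sum]
    rw [smul_comm c α, smul_comm c (i : K)]

theorem cherednik_apply (α : K) (i : Fin N) (f : MvPolynomial (Fin N) K) :
    cherednik α i f =
      α • (X i * pderiv i f) + ∑ p, X (max i p) * divDiff i p f - (i : K) • f := rfl

/-- Conjugation by `s` carries the summand of `p` to that of `s p`, except that for `p = i'` the
prefactors `z_max` do not match, which leaves `f - s f`. The constants `-i` and `-(i + 1)` leave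
another `s f`. -/
theorem rename_swap_cherednik (α : K) {i i' : Fin N} (hi : (i' : ℕ) = i + 1)
    (f : MvPolynomial (Fin N) K) :
    rename (Equiv.swap i i') (cherednik α i f) =
      cherednik α i' (rename (Equiv.swap i i') f) + f := by
  have hne : i ≠ i' := fun h => by simp [h] at hi
  set s := Equiv.swap i i' with hs
  have hsi : s i = i' := Equiv.swap_apply_left _ _
  have hsi' : s i' = i := Equiv.swap_apply_right _ _
  have key : ∀ p, rename s (X (max i p) * divDiff i p f) =
      X (max i' (s p)) * divDiff i' (s p) (rename s f) +
        if p = i' then f - rename s f else 0 := by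
    intro p
    rw [map_mul, rename_X, rename_divDiff, hsi]
    rcases eq_or_ne p i with rfl | h1
    · simp [hsi, hne]
    rcases eq_or_ne p i' with rfl | h2
    · have h3 := mul_divDiff p i (rename s f)
      rw [rename_rename, Equiv.swap_comm, ← hs] at h3
      have h4 : (s : Fin N → Fin N) ∘ s = id := by ext x; simp [hs]
      rw [h4, rename_id_apply] at h3
      have h5 : max i p = p := max_eq_right (by rw [Fin.le_def]; omega)
      have h6 : max p i = p := max_eq_left (by rw [Fin.le_def]; omega)
      rw [h5, hsi', h6, if_pos rfl, ← neg_sub (rename s f) f, ← h3]; ring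
    · have h3 : s p = p := Equiv.swap_apply_of_ne_of_ne h1 h2
      rw [if_neg h2, add_zero, h3]
      congr 2
      rcases lt_or_gt_of_ne h1 with h | h
      · have : p ≤ i' := by rw [Fin.lt_def] at h; rw [Fin.le_def]; omega
        rw [max_eq_left h.le, max_eq_left this, hsi]
      · have : i' ≤ p := by rw [Fin.lt_def] at h; rw [Fin.le_def]; omega
        rw [max_eq_right h.le, max_eq_right this, h3]
  have hsum : rename s (∑ p, X (max i p) * divDiff i p f) =
      ∑ p, X (max i' p) * divDiff i' p (rename s f) + (f - rename s f) := by
    rw [map_sum, Finset.sum_congr rfl fun p _ => key p, Finset.sum_add_distrib,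
      Equiv.sum_comp s fun p => X (max i' p) * divDiff i' p (rename s f)]
    simp
  rw [cherednik_apply, cherednik_apply, map_sub, map_add, hsum, map_smul, map_smul, map_mul,
    rename_X, rename_pderiv, hsi, hi]
  push_cast
  rw [add_smul, one_smul]
  ring

theorem rename_swap_cherednik_right (α : K) {i i' : Fin N} (hi : (i' : ℕ) = i + 1)
    (f : MvPolynomial (Fin N) K) :
    rename (Equiv.swap i i') (cherednik α i' f) =
      cherednik α i (rename (Equiv.swap i i') f) - f := by
  have hinv : ∀ g : MvPolynomial (Fin N) K,
      rename (Equiv.swap i i') (rename (Equiv.swap i i') g) = g := fun g => by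
    rw [rename_rename]
    have h4 : (Equiv.swap i i' : Fin N → Fin N) ∘ Equiv.swap i i' = id := by ext x; simp
    rw [h4, rename_id_apply]
  have h := congrArg (rename (Equiv.swap i i'))
    (rename_swap_cherednik α hi (rename (Equiv.swap i i') f))
  rw [hinv, map_add, hinv f] at h
  rw [h]; ring

theorem rename_swap_cherednik_of_ne (α : K) {i i' j : Fin N} (hi : (i' : ℕ) = i + 1)
    (h1 : j ≠ i) (h2 : j ≠ i') (f : MvPolynomial (Fin N) K) :
    rename (Equiv.swap i i') (cherednik α j f) =
      cherednik α j (rename (Equiv.swap i i') f) := by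
  set s := Equiv.swap i i' with hs
  have hsj : s j = j := Equiv.swap_apply_of_ne_of_ne h1 h2
  have hmax : ∀ p, s (max j p) = max j (s p) := by
    intro p
    have h1' : (j : ℕ) ≠ i := fun h => h1 (Fin.ext h)
    have h2' : (j : ℕ) ≠ i' := fun h => h2 (Fin.ext h)
    rcases eq_or_ne p i with rfl | h3
    · rw [hs, Equiv.swap_apply_left]
      rcases lt_or_gt_of_ne h1' with h | h
      · rw [max_eq_right, max_eq_right, Equiv.swap_apply_left] <;> rw [Fin.le_def] <;> omega
      · rw [max_eq_left, max_eq_left, ← hs, hsj] <;> rw [Fin.le_def] <;> omega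
    rcases eq_or_ne p i' with rfl | h4
    · rw [hs, Equiv.swap_apply_right]
      rcases lt_or_gt_of_ne h2' with h | h
      · rw [max_eq_right, max_eq_right, Equiv.swap_apply_right] <;> rw [Fin.le_def] <;> omega
      · rw [max_eq_left, max_eq_left, ← hs, hsj] <;> rw [Fin.le_def] <;> omega
    · have hp : s p = p := Equiv.swap_apply_of_ne_of_ne h3 h4
      rw [hp]
      rcases max_choice j p with h | h <;> rw [h] <;> assumption
  rw [cherednik_apply, cherednik_apply, map_sub, map_add, map_smul, map_smul, map_mul,
    rename_X, rename_pderiv, hsj, map_sum,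
    ← Equiv.sum_comp s fun p => X (max j p) * divDiff j p (rename s f)]
  simp only [map_mul, rename_X, rename_divDiff, hmax, hsj]

/-- The operator `∑_i ξ_i²`. -/
noncomputable def cherednikSq (α : K) :
    MvPolynomial (Fin N) K →ₗ[K] MvPolynomial (Fin N) K :=
  ∑ i, cherednik α i ∘ₗ cherednik α i

theorem cherednikSq_apply (α : K) (f : MvPolynomial (Fin N) K) :
    cherednikSq α f = ∑ i, cherednik α i (cherednik α i f) := by
  simp [cherednikSq]

/-- The corrections in `s ξ_i = ξ_{i'} s + 1` and `s ξ_{i'} = ξ_i s - 1` cancel in the sum of the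
two squares. -/
theorem rename_swap_cherednikSq (α : K) {i i' : Fin N} (hi : (i' : ℕ) = i + 1)
    (f : MvPolynomial (Fin N) K) :
    rename (Equiv.swap i i') (cherednikSq α f) =
      cherednikSq α (rename (Equiv.swap i i') f) := by
  have hne : i' ≠ i := fun h => by simp [h] at hi
  rw [cherednikSq_apply, cherednikSq_apply, map_sum,
    ← Finset.add_sum_erase _ _ (Finset.mem_univ i), ← Finset.add_sum_erase _ _
      (Finset.mem_erase.2 ⟨hne, Finset.mem_univ i'⟩),
    ← Finset.add_sum_erase _ _ (Finset.mem_univ i), ← Finset.add_sum_erase _ _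
      (Finset.mem_erase.2 ⟨hne, Finset.mem_univ i'⟩), ← add_assoc, ← add_assoc]
  congr 1
  · simp only [rename_swap_cherednik α hi, rename_swap_cherednik_right α hi, map_add, map_sub]
    ring
  · refine Finset.sum_congr rfl fun j hj => ?_
    simp only [Finset.mem_erase] at hj
    rw [rename_swap_cherednik_of_ne α hi hj.2.1 hj.1, rename_swap_cherednik_of_ne α hi hj.2.1 hj.1]

end Cherednik


/-! ### The raising operator -/

section Raising

variable {σ K : Type*} [DecidableEq σ] [Field K]

theorem divDiff_mul (i j : σ) (f g : MvPolynomial σ K) :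
    divDiff i j (f * g) = f * divDiff i j g + divDiff i j f * rename (Equiv.swap i j) g := by
  by_cases h : i = j
  · simp [h]
  · apply divDiff_eq h
    rw [mul_add, mul_left_comm, mul_divDiff, ← mul_assoc, mul_divDiff, map_mul]; ring

theorem rename_swap_eq (i j : σ) (f : MvPolynomial σ K) :
    rename (Equiv.swap i j) f = f - (X i - X j) * divDiff i j f := by
  rw [mul_divDiff]; ring

theorem divDiff_X_mul_left {i j : σ} (h : i ≠ j) (f : MvPolynomial σ K) :
    divDiff i j (X i * f) = X j * divDiff i j f + f := by
  have h1 : divDiff i j (X i : MvPolynomial σ K) = 1 := divDiff_eq h (by simp)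
  rw [divDiff_mul, h1, rename_swap_eq]; ring

theorem divDiff_X_mul_right {i j : σ} (h : i ≠ j) (f : MvPolynomial σ K) :
    divDiff i j (X j * f) = X i * divDiff i j f - f := by
  rw [divDiff_comm, divDiff_X_mul_left h.symm, divDiff_comm i j f]; ring

theorem divDiff_X_mul_of_ne {i j k : σ} (hi : k ≠ i) (hj : k ≠ j) (f : MvPolynomial σ K) :
    divDiff i j (X k * f) = X k * divDiff i j f := by
  rw [divDiff_mul, divDiff_eq_zero (f := X k), zero_mul, add_zero]
  rw [rename_X, Equiv.swap_apply_of_ne_of_ne hi hj]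

variable {n : ℕ}

/-- The raising operator `f ↦ z_N f(z_N, z_1, …, z_{N-1})`. -/
noncomputable def raising (f : MvPolynomial (Fin (n + 1)) K) : MvPolynomial (Fin (n + 1)) K :=
  X (Fin.last n) * rename (finRotate (n + 1)).symm f

theorem finRotate_symm_zero : (finRotate (n + 1)).symm 0 = Fin.last n := by
  rw [Equiv.symm_apply_eq, finRotate_last]

theorem finRotate_castSucc (i : Fin n) : finRotate (n + 1) i.castSucc = i.succ := by
  simp

theorem finRotate_symm_succ (i : Fin n) : (finRotate (n + 1)).symm i.succ = i.castSucc := by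
  rw [Equiv.symm_apply_eq, finRotate_castSucc]

theorem rename_cherednik_succ (α : K) (i : Fin n) (f : MvPolynomial (Fin (n + 1)) K) :
    let g := rename (finRotate (n + 1)).symm f
    rename (finRotate (n + 1)).symm (cherednik α i.succ f) =
      α • (X i.castSucc * pderiv i.castSucc g) +
        (X i.castSucc * divDiff i.castSucc (Fin.last n) g +
          ∑ p : Fin n, X (max i p).castSucc * divDiff i.castSucc p.castSucc g) -
        ((i : K) + 1) • g := by
  intro g
  rw [cherednik_apply, Fin.sum_univ_succ]
  simp only [map_sub, map_add, map_smul, map_mul, rename_X, rename_pderiv, map_sum, rename_divDiff,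
    finRotate_symm_succ, finRotate_symm_zero]
  congr 2
  · congr 1
    · rw [max_eq_left (Fin.zero_le _), finRotate_symm_succ]
    · refine Finset.sum_congr rfl fun p _ => ?_
      rw [← (Fin.strictMono_succ (n := n)).monotone.map_max, finRotate_symm_succ]
  · simp

theorem rename_cherednik_zero (α : K) (f : MvPolynomial (Fin (n + 1)) K) :
    let g := rename (finRotate (n + 1)).symm f
    rename (finRotate (n + 1)).symm (cherednik α 0 f) =
      α • (X (Fin.last n) * pderiv (Fin.last n) g) +
        ∑ p : Fin n, X p.castSucc * divDiff (Fin.last n) p.castSucc g := by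
  intro g
  rw [cherednik_apply, Fin.sum_univ_succ]
  simp only [map_sub, map_add, map_smul, map_mul, rename_X, rename_pderiv, map_sum, rename_divDiff,
    finRotate_symm_succ, finRotate_symm_zero, divDiff_self, max_eq_right (Fin.zero_le _)]
  simp [g]

/-- Only the divided difference with the last variable sees the factor `z_N`. It yields an extra
`-z_N g`, which is the difference of the constants of the two operators. -/
theorem cherednik_castSucc_raising (α : K) (i : Fin n) (f : MvPolynomial (Fin (n + 1)) K) :
    cherednik α i.castSucc (raising f) = raising (cherednik α i.succ f) := by
  have hil : i.castSucc ≠ Fin.last n := i.castSucc_lt_last.ne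
  rw [raising, raising, rename_cherednik_succ]
  set g := rename (finRotate (n + 1)).symm f
  have hsum : ∑ p : Fin n, X (max i.castSucc p.castSucc) *
        divDiff i.castSucc p.castSucc (X (Fin.last n) * g) =
      X (Fin.last n) * ∑ p : Fin n, X (max i p).castSucc * divDiff i.castSucc p.castSucc g := by
    rw [Finset.mul_sum]
    refine Finset.sum_congr rfl fun p _ => ?_
    rw [divDiff_X_mul_of_ne hil.symm p.castSucc_lt_last.ne',
      ← (Fin.strictMono_castSucc (n := n)).monotone.map_max]
    ring
  rw [cherednik_apply, Fin.sum_univ_castSucc, hsum, max_eq_right (Fin.le_last _),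
    divDiff_X_mul_right hil, Derivation.leibniz, pderiv_X_of_ne hil.symm]
  simp only [smul_eq_mul, Algebra.smul_def, Fin.val_castSucc, map_add, map_one]
  ring

/-- Each of the `N - 1 = n` divided differences yields an extra `z_N g`; together they cancel the
constant of `ξ_N`. The shift by `α` is the derivative of the factor `z_N`. -/
theorem cherednik_last_raising (α : K) (f : MvPolynomial (Fin (n + 1)) K) :
    cherednik α (Fin.last n) (raising f) = raising (cherednik α 0 f) + α • raising f := by
  rw [raising, raising, rename_cherednik_zero]
  set g := rename (finRotate (n + 1)).symm f
  have hsum : ∑ p : Fin n, X (max (Fin.last n) p.castSucc) *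
        divDiff (Fin.last n) p.castSucc (X (Fin.last n) * g) =
      X (Fin.last n) * (∑ p : Fin n, X p.castSucc * divDiff (Fin.last n) p.castSucc g) +
        (n : K) • (X (Fin.last n) * g) := by
    have hc : (n : K) • (X (Fin.last n) * g) = ∑ p : Fin n, X (Fin.last n) * g := by
      simp [Nat.cast_smul_eq_nsmul]
    rw [Finset.mul_sum, hc, ← Finset.sum_add_distrib]
    refine Finset.sum_congr rfl fun p _ => ?_
    rw [max_eq_left (Fin.le_last _), divDiff_X_mul_left p.castSucc_lt_last.ne']
    ring
  rw [cherednik_apply, Fin.sum_univ_castSucc, hsum, Derivation.leibniz, pderiv_X_self]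
  simp only [smul_eq_mul, Algebra.smul_def, Fin.val_last, divDiff_self]
  ring

end Raising


/-! ### Triangularity on monomials -/

section Triangularity

variable {N : ℕ} {K : Type*} [Field K]

/-- The elementary step of the order for which the Cherednik operators are triangular: an entry of
`μ` is lowered and a smaller one is raised by the same amount, the two either getting strictly
closer to each other or being exchanged, in which case the larger one has to move to the right. -/
def Lower (ν μ : Fin N →₀ ℕ) : Prop :=
  ∃ (i p : Fin N) (c : Fin N →₀ ℕ) (k l : ℕ), i ≠ p ∧ c i = c p ∧ 0 < l ∧ (0 < k ∨ i < p) ∧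
    μ = c + Finsupp.single i (k + l) ∧ ν = c + Finsupp.single i k + Finsupp.single p l

theorem rename_swap_monomial_of_eq {i p : Fin N} {c : Fin N →₀ ℕ} (hc : c i = c p) :
    rename (Equiv.swap i p) (monomial c (1 : K)) = monomial c 1 := by
  have : Finsupp.mapDomain (Equiv.swap i p) c = c := by
    ext x
    rw [Finsupp.mapDomain_equiv_apply, Equiv.symm_swap]
    rcases eq_or_ne x i with rfl | h1
    · rw [Equiv.swap_apply_left, hc]
    rcases eq_or_ne x p with rfl | h2
    · rw [Equiv.swap_apply_right, hc]
    · rw [Equiv.swap_apply_of_ne_of_ne h1 h2]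
  rw [rename_monomial, this]

theorem divDiff_monomial {i p : Fin N} (hip : i ≠ p) {c : Fin N →₀ ℕ} (hc : c i = c p) (n : ℕ) :
    divDiff i p (monomial (c + Finsupp.single i n) (1 : K)) =
      monomial c 1 * ∑ k ∈ Finset.range n, X i ^ k * X p ^ (n - 1 - k) := by
  have hm : monomial (c + Finsupp.single i n) (1 : K) = monomial c 1 * X i ^ n := by
    rw [X_pow_eq_monomial, monomial_mul, one_mul]
  apply divDiff_eq hip
  rw [mul_left_comm, mul_comm (X i - X p), geom_sum₂_mul, hm, map_mul,
    rename_swap_monomial_of_eq hc, map_pow, rename_X, Equiv.swap_apply_left]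
  ring

theorem monomial_mul_X_pow_mul_X_pow (c : Fin N →₀ ℕ) (i p : Fin N) (k l : ℕ) :
    monomial c (1 : K) * (X i ^ k * X p ^ l) =
      monomial (c + Finsupp.single i k + Finsupp.single p l) 1 := by
  rw [X_pow_eq_monomial, X_pow_eq_monomial, monomial_mul, monomial_mul]
  simp [add_assoc]

theorem monomial_mem_lower {i p : Fin N} {c : Fin N →₀ ℕ} {k l n : ℕ} (hip : i ≠ p)
    (hc : c i = c p) (hl : 0 < l) (hk : 0 < k ∨ i < p) (hn : n = k + l) :
    monomial (c + Finsupp.single i k + Finsupp.single p l) (1 : K) ∈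
      restrictSupport K {ν | Lower ν (c + Finsupp.single i n)} := by
  rw [mem_restrictSupport_iff]
  refine (Finset.coe_subset.2 support_monomial_subset).trans ?_
  simp only [Finset.coe_singleton, Set.singleton_subset_iff]
  exact ⟨i, p, c, k, l, hip, hc, hl, hk, by rw [hn], rfl⟩

theorem X_mul_divDiff_monomial_left {i p : Fin N} (hip : i ≠ p) {c : Fin N →₀ ℕ} (hc : c i = c p)
    {n : ℕ} (hn : 0 < n) :
    X i * divDiff i p (monomial (c + Finsupp.single i n) (1 : K)) -
        monomial (c + Finsupp.single i n) 1 ∈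
      restrictSupport K {ν | Lower ν (c + Finsupp.single i n)} := by
  obtain ⟨n, rfl⟩ : ∃ m, n = m + 1 := ⟨n - 1, by omega⟩
  have h : X i * divDiff i p (monomial (c + Finsupp.single i (n + 1)) (1 : K)) -
      monomial (c + Finsupp.single i (n + 1)) 1 = ∑ k ∈ Finset.range n,
        monomial (c + Finsupp.single i (k + 1) + Finsupp.single p (n - k)) 1 := by
    rw [divDiff_monomial hip hc, Finset.sum_range_succ, mul_add, mul_add]
    have h1 : X i * (monomial c (1 : K) * (X i ^ n * X p ^ (n + 1 - 1 - n))) =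
        monomial (c + Finsupp.single i (n + 1)) 1 := by
      have := monomial_mul_X_pow_mul_X_pow (K := K) c i p (n + 1) 0
      rw [Finsupp.single_zero, add_zero] at this
      rw [← this, Nat.add_sub_cancel, Nat.sub_self]; ring
    rw [h1, add_sub_cancel_right, Finset.mul_sum, Finset.mul_sum]
    refine Finset.sum_congr rfl fun k _ => ?_
    rw [← monomial_mul_X_pow_mul_X_pow, Nat.add_sub_cancel]; ring
  rw [h]
  refine Submodule.sum_mem _ fun k hk => ?_
  rw [Finset.mem_range] at hk
  exact monomial_mem_lower hip hc (by omega) (Or.inl (by omega)) (by omega)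

/-- The term `k = 0` is the full exchange of the two entries, which `Lower` admits because `i < p`.
-/
theorem X_mul_divDiff_monomial_right {i p : Fin N} (hip : i < p) {c : Fin N →₀ ℕ}
    (hc : c i = c p) (n : ℕ) :
    X p * divDiff i p (monomial (c + Finsupp.single i n) (1 : K)) ∈
      restrictSupport K {ν | Lower ν (c + Finsupp.single i n)} := by
  rw [divDiff_monomial hip.ne hc, Finset.mul_sum, Finset.mul_sum]
  refine Submodule.sum_mem _ fun k hk => ?_
  rw [Finset.mem_range] at hk
  have := monomial_mem_lower (K := K) (c := c) (k := k) (l := n - k) hip.ne hc (by omega)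
    (Or.inr hip) (show n = k + (n - k) by omega)
  rw [← monomial_mul_X_pow_mul_X_pow, show n - k = n - 1 - k + 1 by omega, pow_succ] at this
  convert this using 1
  ring

theorem exists_eq_add_single {i p : Fin N} {μ : Fin N →₀ ℕ} (h : μ p ≤ μ i) (hip : i ≠ p) :
    ∃ c : Fin N →₀ ℕ, c i = c p ∧ μ = c + Finsupp.single i (μ i - μ p) := by
  refine ⟨μ - Finsupp.single i (μ i - μ p), ?_, ?_⟩
  · simp [Finsupp.single_eq_of_ne hip.symm]; omega
  · ext x
    rcases eq_or_ne x i with rfl | hx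
    · simp
    · simp [Finsupp.single_eq_of_ne hx]

/-- Owing to the factor `z_max`, the monomial itself survives only if the larger entry stands at the
larger index; the sign tells which of `i` and `p` that is. -/
theorem X_max_mul_divDiff_monomial (i p : Fin N) (μ : Fin N →₀ ℕ) :
    X (max i p) * divDiff i p (monomial μ (1 : K)) -
        ((if p < i ∧ μ p < μ i then (1 : K) else 0) - (if i < p ∧ μ i < μ p then 1 else 0)) •
          monomial μ 1 ∈
      restrictSupport K {ν | Lower ν μ} := by
  rcases eq_or_ne i p with rfl | hip
  · simp
  rcases lt_trichotomy (μ p) (μ i) with h | h | h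
  · obtain ⟨c, hc, hμ⟩ := exists_eq_add_single h.le hip
    rw [if_neg (fun h' : i < p ∧ μ i < μ p => absurd h'.2 h.le.not_gt)]
    rcases lt_or_gt_of_ne hip with h1 | h1
    · rw [if_neg (fun h' : p < i ∧ _ => absurd h'.1 h1.le.not_gt), max_eq_right h1.le, hμ]
      simpa using X_mul_divDiff_monomial_right h1 hc (μ i - μ p)
    · rw [if_pos ⟨h1, h⟩, max_eq_left h1.le, sub_zero, one_smul, hμ]
      exact X_mul_divDiff_monomial_left hip hc (Nat.sub_pos_of_lt h)
  · have : divDiff i p (monomial μ (1 : K)) = 0 :=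
      divDiff_eq_zero (rename_swap_monomial_of_eq h.symm)
    simp [this, h]
  · obtain ⟨c, hc, hμ⟩ := exists_eq_add_single h.le hip.symm
    rw [if_neg (fun h' : p < i ∧ μ p < μ i => absurd h'.2 h.le.not_gt), divDiff_comm]
    rcases lt_or_gt_of_ne hip with h1 | h1
    · rw [if_pos ⟨h1, h⟩, max_eq_right h1.le, zero_sub, neg_smul, one_smul, mul_neg,
        ← neg_sub', Submodule.neg_mem_iff, hμ]
      exact X_mul_divDiff_monomial_left hip.symm hc (Nat.sub_pos_of_lt h)
    · rw [if_neg (fun h' : i < p ∧ _ => absurd h'.1 h1.le.not_gt), max_eq_left h1.le, hμ]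
      simpa using X_mul_divDiff_monomial_right h1 hc (μ p - μ i)

/-- The eigenvalue `α η_i - l'_i` of the Cherednik operator `ξ_i`. -/
def spec (α : K) (η : Fin N → ℕ) (i : Fin N) : K := α * η i - coleg η i

/-- Removing the smaller entries from the `i` positions before `i` leaves those counted by the
second part of `coleg`. -/
theorem sum_sub_eq_neg_coleg (μ : Fin N → ℕ) (i : Fin N) :
    ∑ p, ((if p < i ∧ μ p < μ i then (1 : K) else 0) - (if i < p ∧ μ i < μ p then 1 else 0)) -
      (i : K) = -(coleg μ i : K) := by
  rw [Finset.sum_sub_distrib, Finset.sum_boole, Finset.sum_boole, coleg]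
  have h := Finset.card_filter_add_card_filter_not (s := Finset.univ.filter (· < i)) (fun p => μ p < μ i)
  rw [Finset.filter_filter, Finset.filter_filter] at h
  simp only [not_lt] at h
  have h2 : (Finset.univ.filter (· < i)).card = i := by
    rw [Finset.filter_gt_eq_Iio, Fin.card_Iio]
  rw [h2] at h
  have h3 : ((i : ℕ) : K) = _ := congrArg Nat.cast h.symm
  rw [h3]; push_cast; ring

theorem cherednik_monomial (α : K) (i : Fin N) (μ : Fin N →₀ ℕ) :
    cherednik α i (monomial μ 1) - spec α μ i • monomial μ 1 ∈
      restrictSupport K {ν | Lower ν μ} := by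
  have h1 : X i * pderiv i (monomial μ (1 : K)) = (μ i : K) • monomial μ 1 := by
    rw [X_mul_pderiv_monomial, Nat.cast_smul_eq_nsmul]
  have h2 := Submodule.sum_mem _ fun p (_ : p ∈ Finset.univ) =>
    X_max_mul_divDiff_monomial (K := K) i p μ
  rw [Finset.sum_sub_distrib, ← Finset.sum_smul] at h2
  convert h2 using 1
  rw [cherednik_apply, h1, spec]
  set S := ∑ p, ((if p < i ∧ μ p < μ i then (1 : K) else 0) -
    (if i < p ∧ μ i < μ p then 1 else 0)) with hS
  have h3 : (coleg μ i : K) = i - S := by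
    have := sum_sub_eq_neg_coleg (K := K) μ i
    rw [← hS] at this
    linear_combination this
  rw [h3]
  module

end Triangularity


/-! ### Orders on exponents -/

section Support

variable {N : ℕ} {K : Type*} [Field K]

theorem coeff_cherednik_monomial (α : K) (i : Fin N) {μ ν : Fin N →₀ ℕ} (h : ¬Lower ν μ) :
    coeff ν (cherednik α i (monomial μ 1)) = spec α ν i * coeff ν (monomial μ (1 : K)) := by
  have h1 := cherednik_monomial α i μ
  rw [mem_restrictSupport_iff] at h1
  have h2 : coeff ν (cherednik α i (monomial μ 1) - spec α μ i • monomial μ 1) = 0 := by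
    rw [← notMem_support_iff]
    exact fun h3 => h (h1 h3)
  rw [coeff_sub, coeff_smul, sub_eq_zero, smul_eq_mul] at h2
  rw [h2, coeff_monomial]
  split_ifs with h3
  · rw [h3]
  · simp

theorem cherednik_eq_sum (α : K) (i : Fin N) (f : MvPolynomial (Fin N) K) :
    cherednik α i f = ∑ μ ∈ f.support, coeff μ f • cherednik α i (monomial μ 1) := by
  conv_lhs => rw [f.as_sum, map_sum]
  refine Finset.sum_congr rfl fun μ _ => ?_
  rw [← map_smul, smul_monomial, smul_eq_mul, mul_one]

theorem coeff_cherednik (α : K) (i : Fin N) {f : MvPolynomial (Fin N) K} {ν : Fin N →₀ ℕ}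
    (h : ∀ μ ∈ f.support, ¬Lower ν μ) :
    coeff ν (cherednik α i f) = spec α ν i * coeff ν f := by
  rw [cherednik_eq_sum, coeff_sum]
  conv_rhs => rw [f.as_sum, coeff_sum, Finset.mul_sum]
  refine Finset.sum_congr rfl fun μ hμ => ?_
  rw [coeff_smul, coeff_cherednik_monomial α i (h μ hμ), ← mul_one (coeff μ f), ← smul_eq_mul,
    ← smul_monomial, coeff_smul, smul_eq_mul, smul_eq_mul, mul_one]
  ring

theorem support_cherednik_subset (α : K) (i : Fin N) {f : MvPolynomial (Fin N) K}
    {G : Set (Fin N →₀ ℕ)} (hG : ∀ μ ∈ G, ∀ ν, Lower ν μ → ν ∈ G) (hf : ↑f.support ⊆ G) :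
    ↑(cherednik α i f).support ⊆ G := by
  intro ν hν
  by_contra hn
  have h : ∀ μ ∈ f.support, ¬Lower ν μ := fun μ hμ hl => hn (hG μ (hf hμ) ν hl)
  rw [Finset.mem_coe, mem_support_iff, coeff_cherednik α i h] at hν
  exact hn (hf (mem_support_iff.2 (right_ne_zero_of_mul hν)))

/-- A weight that decreases strictly under `Lower`. -/
def weight (μ : Fin N →₀ ℕ) : ℕ ×ₗ ℕ := toLex (∑ x, μ x ^ 2, ∑ x : Fin N, (N - (x : ℕ)) * μ x)

theorem sum_sq_add_single (c : Fin N →₀ ℕ) (i : Fin N) (k : ℕ) :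
    ∑ x, (c + Finsupp.single i k) x ^ 2 = ∑ x, c x ^ 2 + (2 * c i * k + k ^ 2) := by
  rw [← Finset.add_sum_erase _ _ (Finset.mem_univ i), ← Finset.add_sum_erase _ _ (Finset.mem_univ i),
    Finset.sum_congr rfl (g := fun x => c x ^ 2)]
  · simp; ring
  · intro x hx
    simp [Finsupp.single_eq_of_ne (Finset.ne_of_mem_erase hx)]

theorem sum_mul_add_single (g : Fin N → ℕ) (S : Finset (Fin N)) (c : Fin N →₀ ℕ) (i : Fin N) (k : ℕ) :
    ∑ x ∈ S, g x * (c + Finsupp.single i k) x = ∑ x ∈ S, g x * c x + if i ∈ S then g i * k else 0 := by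
  simp only [Finsupp.add_apply, mul_add, Finset.sum_add_distrib, Finsupp.single_apply, mul_ite,
    mul_zero, Finset.sum_ite_eq]

theorem sum_add_single (S : Finset (Fin N)) (c : Fin N →₀ ℕ) (i : Fin N) (k : ℕ) :
    ∑ x ∈ S, (c + Finsupp.single i k) x = ∑ x ∈ S, c x + if i ∈ S then k else 0 := by
  simpa using sum_mul_add_single (fun _ => 1) S c i k

/-- A step lowers the sum of squares by `2 k l`. For `k = 0` it is an exchange that moves the larger
entry to a position with a smaller factor `N - x`; the inversion is recorded because a weakly
increasing exponent has none. -/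
theorem Lower.sum_sq_lt_or {ν μ : Fin N →₀ ℕ} (h : Lower ν μ) :
    ∑ x, ν x ^ 2 < ∑ x, μ x ^ 2 ∨ ∑ x, ν x ^ 2 = ∑ x, μ x ^ 2 ∧
      ∃ i p, i < p ∧ μ p < μ i ∧
        ∑ x : Fin N, (N - (x : ℕ)) * ν x < ∑ x : Fin N, (N - (x : ℕ)) * μ x := by
  obtain ⟨i, p, c, k, l, hip, hc, hl, hk, rfl, rfl⟩ := h
  have hp : (c + Finsupp.single i k) p = c p := by simp [Finsupp.single_eq_of_ne hip.symm]
  rw [sum_sq_add_single, sum_sq_add_single, sum_sq_add_single, hp, ← hc]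
  rcases Nat.eq_zero_or_pos k with rfl | hk'
  · have hlt : i < p := hk.resolve_left (lt_irrefl _)
    refine Or.inr ⟨by ring, i, p, hlt, ?_, ?_⟩
    · simp [Finsupp.single_eq_of_ne hip.symm, hc, hl]
    · rw [sum_mul_add_single, sum_mul_add_single, sum_mul_add_single]
      simp only [Finset.mem_univ, if_true, mul_zero, add_zero, zero_add]
      have : N - (p : ℕ) < N - i := by have := p.2; rw [Fin.lt_def] at hlt; omega
      exact Nat.add_lt_add_left (Nat.mul_lt_mul_of_pos_right this hl) _
  · left
    have := Nat.mul_pos hk' hl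
    nlinarith

theorem Lower.weight_lt {ν μ : Fin N →₀ ℕ} (h : Lower ν μ) : weight ν < weight μ := by
  rw [weight, weight, Prod.Lex.toLex_lt_toLex]
  rcases h.sum_sq_lt_or with h | ⟨h, _, _, _, _, h'⟩
  · exact Or.inl h
  · exact Or.inr ⟨h, h'⟩

/-- Every sum of entries of `ν` is bounded by a sum of as many entries of `κ`. -/
def SubsetDom (ν κ : Fin N → ℕ) : Prop :=
  ∑ x, ν x = ∑ x, κ x ∧
    ∀ S : Finset (Fin N), ∃ S' : Finset (Fin N), S'.card = S.card ∧ ∑ x ∈ S, ν x ≤ ∑ x ∈ S', κ x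

theorem SubsetDom.trans {ν μ κ : Fin N → ℕ} (h : SubsetDom ν μ) (h' : SubsetDom μ κ) :
    SubsetDom ν κ := by
  refine ⟨h.1.trans h'.1, fun S => ?_⟩
  obtain ⟨S₁, h1, h2⟩ := h.2 S
  obtain ⟨S₂, h3, h4⟩ := h'.2 S₁
  exact ⟨S₂, h3.trans h1, h2.trans h4⟩

theorem Lower.subsetDom {ν μ : Fin N →₀ ℕ} (h : Lower ν μ) : SubsetDom ν μ := by
  obtain ⟨i, p, c, k, l, hip, hc, -, -, rfl, rfl⟩ := h
  constructor
  · simp only [sum_add_single, Finset.mem_univ, if_true]; ring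
  intro S
  simp only [sum_add_single]
  by_cases hi : i ∈ S
  · refine ⟨S, rfl, ?_⟩
    simp only [hi, if_true]
    split_ifs <;> omega
  by_cases hp : p ∈ S
  -- If `S` contains only `p`, replacing `p` by `i` works, as `ν p = c p + l ≤ c i + k + l = μ i`.
  · have hi' : i ∉ S.erase p := fun h => hi (Finset.mem_of_mem_erase h)
    refine ⟨insert i (S.erase p), ?_, ?_⟩
    · rw [Finset.card_insert_of_notMem hi', Finset.card_erase_add_one hp]
    · rw [Finset.sum_insert hi', ← Finset.add_sum_erase _ _ hp]
      simp only [hi, hp, if_true, if_false, Finset.mem_insert_self]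
      omega
  · exact ⟨S, rfl, by simp [hi, hp]⟩

end Support

/-! ### Joint eigenvalues separate compositions -/

section Spectrum

variable {N : ℕ} {K : Type*} [Field K] {α : K}

/-- Position `k` comes before position `i` when the entries of `η` are put into decreasing order,
equal entries being kept in order. -/
def Precedes (η : Fin N → ℕ) (k i : Fin N) : Prop := (i < k ∧ η i < η k) ∨ (k < i ∧ η i ≤ η k)

instance (η : Fin N → ℕ) (k i : Fin N) : Decidable (Precedes η k i) :=
  inferInstanceAs (Decidable (_ ∨ _))

theorem coleg_eq_card (η : Fin N → ℕ) (i : Fin N) :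
    coleg η i = (Finset.univ.filter fun k => Precedes η k i).card := by
  rw [coleg, ← Finset.card_union_of_disjoint, ← Finset.filter_or]
  · rfl
  · rw [Finset.disjoint_filter]
    exact fun k _ h1 h2 => absurd h1.1 h2.1.not_gt

theorem Precedes.trans {η : Fin N → ℕ} {i j k : Fin N} (h1 : Precedes η i j) (h2 : Precedes η j k) :
    Precedes η i k := by
  simp only [Precedes, Fin.lt_def] at *
  by_cases h : i = k
  · subst h; omega
  · have : (i : ℕ) ≠ k := fun h' => h (Fin.ext h')
    omega

theorem not_precedes_self (η : Fin N → ℕ) (i : Fin N) : ¬Precedes η i i := by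
  simp [Precedes]

theorem precedes_or {η : Fin N → ℕ} {i k : Fin N} (h : i ≠ k) :
    Precedes η i k ∨ Precedes η k i := by
  have : (i : ℕ) ≠ k := fun h' => h (Fin.ext h')
  simp only [Precedes, Fin.lt_def]; omega

theorem Precedes.coleg_lt {η : Fin N → ℕ} {k i : Fin N} (h : Precedes η k i) :
    coleg η k < coleg η i := by
  rw [coleg_eq_card, coleg_eq_card]
  refine Finset.card_lt_card (Finset.ssubset_iff_of_subset ?_ |>.2 ⟨k, by simpa, ?_⟩)
  · intro x hx
    simp only [Finset.mem_filter, Finset.mem_univ, true_and] at hx ⊢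
    exact hx.trans h
  · simpa using not_precedes_self η k

theorem Precedes.exists_spec_sub {η : Fin N → ℕ} {k i : Fin N} (h : Precedes η k i) (α : K) :
    ∃ m n : ℕ, 0 < n ∧ spec α η k - spec α η i = α * m + n := by
  refine ⟨η k - η i, coleg η i - coleg η k, Nat.sub_pos_of_lt h.coleg_lt, ?_⟩
  have : η i ≤ η k := by rcases h with h | h <;> omega
  rw [Nat.cast_sub this, Nat.cast_sub h.coleg_lt.le, spec, spec]; ring

variable [CharZero K]

theorem mul_natCast_add_natCast_ne_zero (hα : ∀ q : ℚ, q ≤ 0 → α ≠ (q : K)) (m : ℕ) {n : ℕ}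
    (hn : 0 < n) : α * m + n ≠ 0 := by
  intro h
  rcases Nat.eq_zero_or_pos m with rfl | hm
  · simp at h; omega
  · refine hα (-(n / m : ℚ)) (neg_nonpos.2 (by positivity)) ?_
    have : (m : K) ≠ 0 := Nat.cast_ne_zero.2 hm.ne'
    push_cast
    rw [eq_neg_iff_add_eq_zero]
    field_simp
    rw [h, mul_zero]

/-- The eigenvalues determine which of two positions precedes the other, since `α m + n` and `-(α m'
+ n')` cannot agree when `n, n' > 0`. The precedence relation gives every `coleg`, after which `η i`
can be read off. -/
theorem spec_injective (hα : ∀ q : ℚ, q ≤ 0 → α ≠ (q : K)) {ν η : Fin N → ℕ}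
    (h : spec α ν = spec α η) : ν = η := by
  have key : ∀ (ν η : Fin N → ℕ), spec α ν = spec α η → ∀ i k, Precedes ν k i → Precedes η k i := by
    intro ν η h i k hk
    by_contra hn
    have hki : k ≠ i := by rintro rfl; exact not_precedes_self _ _ hk
    obtain ⟨m, n, hpos, e⟩ := hk.exists_spec_sub α
    obtain ⟨m', n', _, e'⟩ := ((precedes_or hki).resolve_left hn).exists_spec_sub α
    refine mul_natCast_add_natCast_ne_zero hα (m + m') (n := n + n') (by omega) ?_
    rw [h] at e
    push_cast
    linear_combination -e - e'
  funext i
  have hc : coleg ν i = coleg η i := by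
    rw [coleg_eq_card, coleg_eq_card]
    congr 1
    ext k
    simpa using ⟨key ν η h i k, key η ν h.symm i k⟩
  have h1 := congrFun h i
  rw [spec, spec, hc] at h1
  have h0 : α ≠ 0 := by simpa using hα 0 le_rfl
  exact_mod_cast mul_left_cancel₀ h0 (sub_left_injective h1)

/-- The support of a joint eigenvector of the Cherednik operators. -/
theorem support_subset_of_cherednik_eq (hα : ∀ q : ℚ, q ≤ 0 → α ≠ (q : K)) {η : Fin N →₀ ℕ}
    {f : MvPolynomial (Fin N) K} (hf : ∀ i, cherednik α i f = spec α η i • f)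
    {G : Set (Fin N →₀ ℕ)} (hG : ∀ μ ∈ G, ∀ ν, Lower ν μ → ν ∈ G) (hη : η ∈ G) :
    ↑f.support ⊆ G := by
  classical
  by_contra hn
  rw [Set.not_subset] at hn
  obtain ⟨μ, hμ, hμG⟩ := hn
  -- A heaviest exponent `ν` outside `G` is not below any exponent of `f`. So each `ξ_i` acts on its
  -- coefficient by `spec α ν i`, which forces `ν = η`, an element of `G`.
  obtain ⟨ν, hν, hmax⟩ := (f.support.filter (· ∉ G)).exists_max_image weight
    ⟨μ, Finset.mem_filter.2 ⟨hμ, hμG⟩⟩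
  rw [Finset.mem_filter] at hν
  have h : ∀ μ ∈ f.support, ¬Lower ν μ := fun μ hμ hl => by
    by_cases hg : μ ∈ G
    · exact hν.2 (hG μ hg ν hl)
    · exact absurd hl.weight_lt (hmax μ (Finset.mem_filter.2 ⟨hμ, hg⟩)).not_gt
  refine hν.2 ?_
  have : (ν : Fin N → ℕ) = η := spec_injective hα <| funext fun i => by
    have h1 := coeff_cherednik α i h
    rw [hf, coeff_smul, smul_eq_mul] at h1
    exact (mul_right_cancel₀ (mem_support_iff.1 hν.1) h1).symm
  rwa [DFunLike.coe_injective this]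

end Spectrum


/-! ### How `d`, `e` and the eigenvalues change under the two moves -/

section Recursion

variable {N n : ℕ} {K : Type*} [Field K]

/-- `k` contributes to the leg of the node `(i, j)`. -/
def InLeg (η : Fin N → ℕ) (i : Fin N) (j : ℕ) (k : Fin N) : Prop :=
  (i < k ∧ j ≤ η k ∧ η k ≤ η i) ∨ (k < i ∧ j ≤ η k + 1 ∧ η k + 1 ≤ η i)

instance (η : Fin N → ℕ) (i : Fin N) (j : ℕ) (k : Fin N) : Decidable (InLeg η i j k) :=
  inferInstanceAs (Decidable (_ ∨ _))

theorem leg_eq_card (η : Fin N → ℕ) (i : Fin N) (j : ℕ) :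
    leg η i j = (Finset.univ.filter (InLeg η i j)).card := by
  rw [leg, ← Finset.card_union_of_disjoint, ← Finset.filter_or]
  · rfl
  · rw [Finset.disjoint_filter]
    exact fun k _ h1 h2 => absurd h1.1 h2.1.not_gt

theorem card_filter_equiv {σ : Type*} [Fintype σ] (g : Equiv.Perm σ) {p q : σ → Prop}
    [DecidablePred p] [DecidablePred q] (h : ∀ x, p x ↔ q (g x)) :
    (Finset.univ.filter p).card = (Finset.univ.filter q).card :=
  Finset.card_equiv g fun x => by simp [h]

theorem prod_Icc_one_succ {M : Type*} [CommMonoid M] (f : ℕ → M) (m : ℕ) :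
    ∏ j ∈ Finset.Icc 1 (m + 1), f j = f 1 * ∏ j ∈ Finset.Icc 1 m, f (j + 1) := by
  induction m with
  | zero => simp
  | succ m ih =>
    rw [Finset.prod_Icc_succ_top (by omega), ih, Finset.prod_Icc_succ_top (by omega), mul_assoc]

/-- The composition `(η_2, …, η_N, η_1 + 1)`. -/
def raise (η : Fin (n + 1) → ℕ) (x : Fin (n + 1)) : ℕ :=
  η (finRotate (n + 1) x) + if x = Fin.last n then 1 else 0

theorem raise_last (η : Fin (n + 1) → ℕ) : raise η (Fin.last n) = η 0 + 1 := by
  rw [raise, if_pos rfl, finRotate_last]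

theorem raise_castSucc (η : Fin (n + 1) → ℕ) (i : Fin n) : raise η i.castSucc = η i.succ := by
  rw [raise, if_neg i.castSucc_lt_last.ne, finRotate_castSucc, add_zero]

theorem precedes_raise (η : Fin (n + 1) → ℕ) (k i : Fin (n + 1)) :
    Precedes (raise η) k i ↔ Precedes η (finRotate (n + 1) k) (finRotate (n + 1) i) := by
  induction k using Fin.lastCases with
  | last =>
    induction i using Fin.lastCases with
    | last => simp [not_precedes_self]
    | cast i =>
      rw [finRotate_last, finRotate_castSucc, Precedes, Precedes, raise_last, raise_castSucc]
      simp only [Fin.lt_def, Fin.val_last, Fin.val_castSucc, Fin.val_succ, Fin.val_zero]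
      have := i.2
      omega
  | cast k =>
    induction i using Fin.lastCases with
    | last =>
      rw [finRotate_last, finRotate_castSucc, Precedes, Precedes, raise_last, raise_castSucc]
      simp only [Fin.lt_def, Fin.val_last, Fin.val_castSucc, Fin.val_succ, Fin.val_zero]
      have := k.2
      omega
    | cast i =>
      rw [finRotate_castSucc, finRotate_castSucc, Precedes, Precedes, raise_castSucc,
        raise_castSucc]
      simp only [Fin.lt_def, Fin.val_castSucc, Fin.val_succ]
      omega

theorem coleg_raise (η : Fin (n + 1) → ℕ) (i : Fin (n + 1)) :
    coleg (raise η) i = coleg η (finRotate (n + 1) i) := by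
  rw [coleg_eq_card, coleg_eq_card]
  exact card_filter_equiv (finRotate (n + 1)) fun k => precedes_raise η k i

theorem leg_raise_castSucc (η : Fin (n + 1) → ℕ) (i : Fin n) (j : ℕ) :
    leg (raise η) i.castSucc j = leg η i.succ j := by
  rw [leg_eq_card, leg_eq_card]
  refine card_filter_equiv (finRotate (n + 1)) fun k => ?_
  induction k using Fin.lastCases with
  | last =>
    rw [finRotate_last, InLeg, InLeg, raise_last, raise_castSucc]
    simp only [Fin.lt_def, Fin.val_last, Fin.val_castSucc, Fin.val_succ, Fin.val_zero]
    have := i.2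
    omega
  | cast k =>
    rw [finRotate_castSucc, InLeg, InLeg, raise_castSucc, raise_castSucc]
    simp only [Fin.lt_def, Fin.val_castSucc, Fin.val_succ]
    omega

theorem inLeg_raise_last (η : Fin (n + 1) → ℕ) (j : ℕ) (k : Fin (n + 1)) :
    InLeg (raise η) (Fin.last n) (j + 1) k ↔ InLeg η 0 j (finRotate (n + 1) k) := by
  induction k using Fin.lastCases with
  | last => simp [InLeg]
  | cast k =>
    rw [finRotate_castSucc, InLeg, InLeg, raise_castSucc, raise_last]
    simp only [Fin.lt_def, Fin.val_castSucc, Fin.val_succ, Fin.val_last, Fin.val_zero]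
    have := k.2
    omega

theorem leg_raise_last (η : Fin (n + 1) → ℕ) (j : ℕ) :
    leg (raise η) (Fin.last n) (j + 1) = leg η 0 j := by
  rw [leg_eq_card, leg_eq_card]
  exact card_filter_equiv (finRotate (n + 1)) fun k => inLeg_raise_last η j k

/-- In the fictitious column 0 the leg has no lower bound, so every other position lies in the leg
of row 0 or precedes it. After raising, this leg belongs to the node in column 1 of the last row. -/
theorem leg_zero_add_coleg (η : Fin (n + 1) → ℕ) : leg η 0 0 + coleg η 0 = n := by
  rw [leg_eq_card, coleg_eq_card, ← Finset.card_union_of_disjoint, ← Finset.filter_or]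
  · have : (Finset.univ.filter fun k => InLeg η 0 0 k ∨ Precedes η k 0) =
        Finset.univ.erase 0 := by
      ext k
      simp only [Finset.mem_filter, Finset.mem_univ, true_and, Finset.mem_erase, and_true, InLeg,
        Precedes, Fin.not_lt_zero, false_and, or_false, Nat.zero_le, ← Fin.pos_iff_ne_zero]
      omega
    rw [this, Finset.card_erase_of_mem (Finset.mem_univ _)]
    simp
  · rw [Finset.disjoint_filter]
    intro k _ h1 h2
    simp only [InLeg, Precedes, Fin.not_lt_zero, false_and, or_false] at h1 h2
    omega

/-- The nodes of the first row move one column to the right with unchanged arms and legs; the only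
new factor is that of column 1. -/
theorem d_raise (α : K) (η : Fin (n + 1) → ℕ) :
    d α (raise η) = d α η * (α * (η 0 + 1) + (n + 1 : ℕ) - coleg η 0) := by
  rw [d, d, Fin.prod_univ_castSucc, Fin.prod_univ_succ, raise_last, prod_Icc_one_succ]
  have h0 := leg_raise_last η 0
  rw [zero_add] at h0
  have h1 : (leg η 0 0 : K) = n - coleg η 0 := by
    rw [eq_sub_iff_add_eq, ← Nat.cast_add, leg_zero_add_coleg]
  simp only [arm, raise_last, raise_castSucc, leg_raise_castSucc, leg_raise_last,
    Nat.add_sub_add_right, Nat.add_sub_cancel, h0, h1]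
  push_cast
  ring

/-- Here the new factor comes from the end of the row. It equals the new factor of `d`, so `e / d`
does not change. -/
theorem e_raise (α : K) (η : Fin (n + 1) → ℕ) :
    e α (raise η) = e α η * (α * (η 0 + 1) + (n + 1 : ℕ) - coleg η 0) := by
  rw [e, e, Fin.prod_univ_castSucc, Fin.prod_univ_succ, raise_last,
    Finset.prod_Icc_succ_top (by omega)]
  simp only [raise_castSucc, coleg_raise, finRotate_last, finRotate_castSucc, coarm,
    Nat.add_sub_cancel]
  push_cast
  ring

theorem spec_raise_castSucc (α : K) (η : Fin (n + 1) → ℕ) (i : Fin n) :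
    spec α (raise η) i.castSucc = spec α η i.succ := by
  rw [spec, spec, raise_castSucc, coleg_raise, finRotate_castSucc]

theorem spec_raise_last (α : K) (η : Fin (n + 1) → ℕ) :
    spec α (raise η) (Fin.last n) = spec α η 0 + α := by
  rw [spec, spec, raise_last, coleg_raise, finRotate_last]
  push_cast; ring

section Exchange

variable {η : Fin N → ℕ} {i i' : Fin N}

theorem swap_cases (i i' x : Fin N) :
    (x = i ∧ Equiv.swap i i' x = i') ∨ (x = i' ∧ Equiv.swap i i' x = i) ∨
      ((x : ℕ) ≠ i ∧ (x : ℕ) ≠ i' ∧ Equiv.swap i i' x = x) := by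
  by_cases h1 : x = i
  · subst h1; simp
  by_cases h2 : x = i'
  · subst h2; simp
  · exact Or.inr (Or.inr ⟨fun h => h1 (Fin.ext h), fun h => h2 (Fin.ext h),
      Equiv.swap_apply_of_ne_of_ne h1 h2⟩)

theorem precedes_comp_swap (hi : (i' : ℕ) = i + 1) (hη : η i < η i') (k x : Fin N) :
    Precedes (η ∘ Equiv.swap i i') k x ↔
      Precedes η (Equiv.swap i i' k) (Equiv.swap i i' x) := by
  rw [Precedes, Precedes]
  simp only [Function.comp, Fin.lt_def]
  rcases swap_cases i i' k with ⟨h1, -⟩ | ⟨h1, -⟩ | ⟨h1, h1', h1''⟩ <;>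
  rcases swap_cases i i' x with ⟨h2, -⟩ | ⟨h2, -⟩ | ⟨h2, h2', h2''⟩ <;>
  simp only [*, -hη, -hi, Equiv.swap_apply_left, Equiv.swap_apply_right] <;> omega

theorem coleg_comp_swap (hi : (i' : ℕ) = i + 1) (hη : η i < η i') (x : Fin N) :
    coleg (η ∘ Equiv.swap i i') x = coleg η (Equiv.swap i i' x) := by
  rw [coleg_eq_card, coleg_eq_card]
  exact card_filter_equiv (Equiv.swap i i') fun k => precedes_comp_swap hi hη k x

theorem spec_comp_swap (α : K) (hi : (i' : ℕ) = i + 1) (hη : η i < η i') (x : Fin N) :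
    spec α (η ∘ Equiv.swap i i') x = spec α η (Equiv.swap i i' x) := by
  rw [spec, spec, coleg_comp_swap hi hη, Function.comp]

theorem e_comp_swap (α : K) (hi : (i' : ℕ) = i + 1) (hη : η i < η i') :
    e α (η ∘ Equiv.swap i i') = e α η := by
  rw [e, e, ← Equiv.prod_comp (Equiv.swap i i') fun x => ∏ j ∈ Finset.Icc 1 (η x),
    (α * ((coarm j : K) + 1) + (N : K) - (coleg η x : K))]
  simp only [coleg_comp_swap hi hη, Function.comp]

theorem leg_comp_swap_of_ne (hi : (i' : ℕ) = i + 1) (hη : η i < η i') {x : Fin N} (hx : x ≠ i)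
    (j : ℕ) : leg (η ∘ Equiv.swap i i') x j = leg η (Equiv.swap i i' x) j := by
  rw [leg_eq_card, leg_eq_card]
  refine card_filter_equiv (Equiv.swap i i') fun k => ?_
  rw [InLeg, InLeg]
  simp only [Function.comp, Fin.lt_def]
  rcases swap_cases i i' x with ⟨h2, -⟩ | ⟨h2, -⟩ | ⟨h2, h2', h2''⟩
  · exact absurd h2 hx
  all_goals
    rcases swap_cases i i' k with ⟨h1, -⟩ | ⟨h1, -⟩ | ⟨h1, h1', h1''⟩ <;>
    simp only [*, -hη, -hi, Equiv.swap_apply_left, Equiv.swap_apply_right] <;> omega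

/-- Above the longer row, the shorter one counts towards legs up to column `η i + 1`; below it, only
up to column `η i`. -/
theorem leg_comp_swap_left (hi : (i' : ℕ) = i + 1) (j : ℕ) (hη : η i < η i') :
    leg η i' j = leg (η ∘ Equiv.swap i i') i j + if j = η i + 1 then 1 else 0 := by
  have h0 : ∀ k, InLeg (η ∘ Equiv.swap i i') i j k ↔
      InLeg η i' j (Equiv.swap i i' k) ∧ (k = i' → j ≠ η i + 1) := by
    intro k
    rw [InLeg, InLeg]
    simp only [Function.comp, Fin.lt_def]
    rcases swap_cases i i' k with ⟨h1, -⟩ | ⟨h1, -⟩ | ⟨h1, h1', h1''⟩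
    · simp only [h1, Equiv.swap_apply_left, Fin.ext_iff]; omega
    · simp only [h1, Equiv.swap_apply_left, Equiv.swap_apply_right, forall_const]; omega
    · simp only [h1'', Equiv.swap_apply_left, Fin.ext_iff]; omega
  have h1 : leg η i' j = (Finset.univ.filter fun k => InLeg η i' j (Equiv.swap i i' k)).card := by
    rw [leg_eq_card]
    exact (card_filter_equiv (Equiv.swap i i') fun k => Iff.rfl).symm
  rw [h1, leg_eq_card]
  split_ifs with hj
  · have : (Finset.univ.filter fun k => InLeg η i' j (Equiv.swap i i' k)) =
        insert i' (Finset.univ.filter (InLeg (η ∘ Equiv.swap i i') i j)) := by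
      ext k
      simp only [Finset.mem_filter, Finset.mem_univ, true_and, Finset.mem_insert, h0]
      by_cases hk : k = i'
      · simp only [hk, true_or, iff_true, Equiv.swap_apply_right, InLeg, Fin.lt_def]; omega
      · simp [hk]
    rw [this, Finset.card_insert_of_notMem]
    simp only [Finset.mem_filter, Finset.mem_univ, true_and]
    exact fun h => absurd hj (((h0 i').1 h).2 rfl)
  · rw [add_zero]
    congr 1
    ext k
    simp [h0, hj]

/-- The difference `δ` is given by the arm and leg of the node `(i', η i + 1)`, whose factor in `d`
is therefore `δ + 1`. -/
theorem spec_sub_spec_eq (α : K) (hi : (i' : ℕ) = i + 1) (hη : η i < η i') :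
    spec α η i' - spec α η i = α * (η i' - η i : ℕ) + leg η i' (η i + 1) := by
  have h : coleg η i = coleg η i' + leg η i' (η i + 1) := by
    rw [coleg_eq_card η i', leg_eq_card, ← Finset.card_union_of_disjoint, ← Finset.filter_or,
      coleg_eq_card]
    · refine card_filter_equiv (Equiv.swap i i') fun k => ?_
      rw [InLeg, Precedes, Precedes]
      simp only [Fin.lt_def]
      rcases swap_cases i i' k with ⟨h1, -⟩ | ⟨h1, -⟩ | ⟨h1, h1', h1''⟩ <;>
      simp only [*, -hη, -hi, Equiv.swap_apply_left, Equiv.swap_apply_right] <;> omega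
    · rw [Finset.disjoint_filter]
      intro k _
      rw [InLeg, Precedes]
      simp only [Fin.lt_def]
      omega
  rw [spec, spec, h, Nat.cast_sub hη.le]
  push_cast; ring

/-- Only the node in column `η i + 1` of the longer row changes its factor, from `δ + 1` to `δ`. -/
theorem d_comp_swap (α : K) (hi : (i' : ℕ) = i + 1) (hη : η i < η i') :
    d α (η ∘ Equiv.swap i i') * (spec α η i' - spec α η i + 1) =
      d α η * (spec α η i' - spec α η i) := by
  have hne : i ≠ i' := fun h => by simp [h] at hη
  rw [spec_sub_spec_eq α hi hη, d, d, ← Equiv.prod_comp (Equiv.swap i i') fun x =>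
    ∏ j ∈ Finset.Icc 1 (η x), (α * ((arm η x j : K) + 1) + (leg η x j : K) + 1),
    ← Finset.mul_prod_erase _ _ (Finset.mem_univ i), ← Finset.mul_prod_erase _ (fun x =>
    ∏ j ∈ Finset.Icc 1 (η (Equiv.swap i i' x)), _) (Finset.mem_univ i)]
  have h1 : ∀ x ∈ Finset.univ.erase i, ∏ j ∈ Finset.Icc 1 ((η ∘ Equiv.swap i i') x),
      (α * ((arm (η ∘ Equiv.swap i i') x j : K) + 1) +
        (leg (η ∘ Equiv.swap i i') x j : K) + 1) =
      ∏ j ∈ Finset.Icc 1 (η (Equiv.swap i i' x)), (α * ((arm η (Equiv.swap i i' x) j : K) + 1) +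
        (leg η (Equiv.swap i i' x) j : K) + 1) := by
    intro x hx
    refine Finset.prod_congr rfl fun j _ => ?_
    rw [leg_comp_swap_of_ne hi hη (Finset.ne_of_mem_erase hx), arm, arm, Function.comp]
  have hmem : η i + 1 ∈ Finset.Icc 1 (η i') := Finset.mem_Icc.2 ⟨by omega, hη⟩
  have h2 : ∀ j ∈ (Finset.Icc 1 (η i')).erase (η i + 1),
      α * ((arm (η ∘ Equiv.swap i i') i j : K) + 1) + (leg (η ∘ Equiv.swap i i') i j : K) + 1 =
      α * ((arm η i' j : K) + 1) + (leg η i' j : K) + 1 := by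
    intro j hj
    rw [leg_comp_swap_left hi j hη, if_neg (Finset.ne_of_mem_erase hj), add_zero, arm, arm,
      Function.comp, Equiv.swap_apply_left]
  have h3 : (leg η i' (η i + 1) : K) = leg (η ∘ Equiv.swap i i') i (η i + 1) + 1 := by
    rw [leg_comp_swap_left hi _ hη, if_pos rfl]; push_cast; rfl
  have h4 : ((η i' - η i : ℕ) : K) = (η i' - (η i + 1) : ℕ) + 1 := by
    rw [← Nat.cast_succ]; congr 1; omega
  rw [Finset.prod_congr rfl h1, Function.comp, Equiv.swap_apply_left,
    ← Finset.mul_prod_erase _ _ hmem, ← Finset.mul_prod_erase _ (fun j =>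
      α * ((arm η i' j : K) + 1) + (leg η i' j : K) + 1) hmem,
    Finset.prod_congr rfl fun j hj => h2 j hj, h3, h4, arm, arm, Function.comp,
    Equiv.swap_apply_left]
  ring

end Exchange

end Recursion


/-! ### Construction and evaluation of nonsymmetric Jack polynomials -/

section NonsymmetricJack

variable {N n : ℕ} {K : Type*} [Field K] {α : K}

/-- `E` is the nonsymmetric Jack polynomial `E_η`. -/
def IsNonsymmetricJack (α : K) (η : Fin N →₀ ℕ) (E : MvPolynomial (Fin N) K) : Prop :=
  (∀ i, cherednik α i E = spec α η i • E) ∧ coeff η E = 1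

theorem isNonsymmetricJack_zero (α : K) : IsNonsymmetricJack α (0 : Fin N →₀ ℕ) 1 := by
  refine ⟨fun i => ?_, by simp⟩
  have h : ∀ p, divDiff i p (1 : MvPolynomial (Fin N) K) = 0 := fun p =>
    divDiff_eq_zero (by simp)
  have h2 : coleg (0 : Fin N → ℕ) i = i := by
    rw [coleg]
    simp [Finset.filter_gt_eq_Iio]
  rw [cherednik_apply, spec, Finsupp.coe_zero, h2]
  simp [h]

theorem eval_one_rename {σ : Type*} (g : σ → σ) (f : MvPolynomial σ K) :
    eval (fun _ => (1 : K)) (rename g f) = eval (fun _ => 1) f := by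
  rw [eval_rename]; rfl

theorem coeff_rename_perm {σ : Type*} (g : Equiv.Perm σ) (ν : σ →₀ ℕ) (f : MvPolynomial σ K) :
    coeff ν (rename g f) = coeff (ν.mapDomain g.symm) f := by
  conv_rhs => rw [← coeff_rename_mapDomain g g.injective, ← Finsupp.mapDomain_comp]
  simp

theorem raise_eq (η : Fin (n + 1) →₀ ℕ) :
    raise η = (η.mapDomain (finRotate (n + 1)).symm + Finsupp.single (Fin.last n) 1 :
      Fin (n + 1) →₀ ℕ) := by
  funext x
  rw [raise, Finsupp.add_apply, Finsupp.mapDomain_equiv_apply, Equiv.symm_symm,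
    Finsupp.single_apply]
  simp only [eq_comm]

theorem IsNonsymmetricJack.raising {η η' : Fin (n + 1) →₀ ℕ} {E : MvPolynomial (Fin (n + 1)) K}
    (h : IsNonsymmetricJack α η E) (hη' : (η' : Fin (n + 1) → ℕ) = raise η) :
    IsNonsymmetricJack α η' (raising E) := by
  have hsmul : ∀ c : K, Jack.raising (c • E) = c • Jack.raising E := fun c => by
    rw [Jack.raising, Jack.raising, map_smul, mul_smul_comm]
  refine ⟨fun i => ?_, ?_⟩
  · rw [hη']
    induction i using Fin.lastCases with
    | last => rw [cherednik_last_raising, h.1, hsmul, spec_raise_last, add_smul]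
    | cast i => rw [cherednik_castSucc_raising, h.1, hsmul, spec_raise_castSucc]
  · rw [raise_eq] at hη'
    rw [DFunLike.coe_injective hη', Jack.raising, mul_comm, coeff_mul_X, coeff_rename_mapDomain _
      (Equiv.injective _), h.2]

theorem eval_raising (E : MvPolynomial (Fin (n + 1)) K) :
    eval (fun _ => (1 : K)) (raising E) = eval (fun _ => 1) E := by
  rw [raising, map_mul, eval_one_rename, eval_X, one_mul]

theorem lower_comp_swap {η η' : Fin N →₀ ℕ} {i i' : Fin N} (hlt : i < i') (hη : η i < η i')
    (hη' : (η' : Fin N → ℕ) = η ∘ Equiv.swap i i') : Lower η η' := by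
  have e1 : η' i = η i' := by rw [hη', Function.comp, Equiv.swap_apply_left]
  have e2 : η' i' = η i := by rw [hη', Function.comp, Equiv.swap_apply_right]
  obtain ⟨c, hc, hμ⟩ := exists_eq_add_single (μ := η') (by rw [e1, e2]; exact hη.le) hlt.ne
  refine ⟨i, i', c, 0, η' i - η' i', hlt.ne, hc, by omega, Or.inr hlt, by rwa [zero_add], ?_⟩
  ext x
  have hx : η x = η' (Equiv.swap i i' x) := by rw [hη', Function.comp, Equiv.swap_apply_self]
  have hμx : ∀ y, η' y = c y + if i = y then η' i - η' i' else 0 := fun y => by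
    conv_lhs => rw [hμ]
    rw [Finsupp.add_apply, Finsupp.single_apply]
  rw [hx, hμx]
  simp only [Finsupp.add_apply, Finsupp.single_zero, add_zero, Finsupp.single_apply]
  rcases swap_cases i i' x with ⟨rfl, h⟩ | ⟨rfl, h⟩ | ⟨h1, h2, h⟩
  · rw [h, hc]; simp [hlt.ne, hlt.ne']
  · rw [h, hc]; simp
  · rw [h]
    have h1' : i ≠ x := fun h => h1 (by rw [h])
    have h2' : i' ≠ x := fun h => h2 (by rw [h])
    simp [h1', h2']

theorem IsNonsymmetricJack.exchange [CharZero K] (hα : ∀ q : ℚ, q ≤ 0 → α ≠ (q : K))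
    {η η' : Fin N →₀ ℕ} {i i' : Fin N} (hi : (i' : ℕ) = i + 1) (hη : η i < η i')
    (hη' : (η' : Fin N → ℕ) = η ∘ Equiv.swap i i') {E : MvPolynomial (Fin N) K}
    (h : IsNonsymmetricJack α η E) (hδ : spec α η i' - spec α η i ≠ 0) :
    IsNonsymmetricJack α η'
      (rename (Equiv.swap i i') E + (spec α η i' - spec α η i)⁻¹ • E) := by
  have hlt : i < i' := by rw [Fin.lt_def]; omega
  set δ := spec α η i' - spec α η i with hδ'
  constructor
  · intro x
    rw [hη', spec_comp_swap α hi hη, map_add, map_smul, h.1]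
    rcases swap_cases i i' x with ⟨rfl, hx⟩ | ⟨rfl, hx⟩ | ⟨h1, h2, hx⟩
    · have h1 := rename_swap_cherednik_right α hi E
      rw [h.1, map_smul, eq_sub_iff_add_eq] at h1
      rw [← h1, hx]
      have : spec α η i' = spec α η x + δ := by rw [hδ']; ring
      rw [this]
      -- The coefficient `δ⁻¹` is chosen so that the shift of the eigenvalue on `δ⁻¹ E` absorbs the
      -- term `E` left over by the relation between `s` and `ξ`.
      have : (δ⁻¹ * δ) • E = E := by rw [inv_mul_cancel₀ hδ, one_smul]
      linear_combination (norm := module) -this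
    · have h1 := rename_swap_cherednik α hi E
      rw [h.1, map_smul, ← sub_eq_iff_eq_add] at h1
      rw [← h1, hx]
      have : spec α η x = spec α η i + δ := by rw [hδ']; ring
      rw [this]
      have : (δ⁻¹ * δ) • E = E := by rw [inv_mul_cancel₀ hδ, one_smul]
      linear_combination (norm := module) this
    · rw [← rename_swap_cherednik_of_ne α hi (fun h => h1 (by rw [h])) (fun h => h2 (by rw [h])),
        h.1, map_smul, hx, smul_add, smul_comm]
  -- As `η'` is heavier than `η`, it does not occur in `E`, and its coefficient comes from `s E`
  -- alone.
  · have h1 : coeff η' E = 0 := by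
      have hs := support_subset_of_cherednik_eq hα h.1 (G := {ν | weight ν ≤ weight η})
        (fun μ hμ ν hl => hl.weight_lt.le.trans hμ) (le_refl (weight η))
      rw [← notMem_support_iff]
      exact fun hn => absurd (lower_comp_swap hlt hη hη').weight_lt (hs hn).not_gt
    have h2 : η'.mapDomain (Equiv.swap i i').symm = η := by
      ext x
      rw [Finsupp.mapDomain_equiv_apply, hη']
      simp
    rw [coeff_add, coeff_smul, h1, coeff_rename_perm, h2, h.2]
    simp

/-- Induction on the modulus, then on the weight. A positive last entry makes `η` a raised
composition; a descent can be undone by an exchange, which lowers the weight. Only `η = 0` is weakly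
increasing with last entry zero. -/
theorem exists_isNonsymmetricJack [CharZero K] (hα : ∀ q : ℚ, q ≤ 0 → α ≠ (q : K))
    (η : Fin N →₀ ℕ) : ∃ E : MvPolynomial (Fin N) K, IsNonsymmetricJack α η E ∧
      eval (fun _ => 1) E * d α η = e α η := by
  have base : ∃ E : MvPolynomial (Fin N) K, IsNonsymmetricJack α (0 : Fin N →₀ ℕ) E ∧
      eval (fun _ => 1) E * d α (0 : Fin N →₀ ℕ) = e α (0 : Fin N →₀ ℕ) :=
    ⟨1, isNonsymmetricJack_zero α, by simp [d, e]⟩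
  rcases N with _ | n
  · rwa [Subsingleton.elim η 0]
  obtain ⟨s, hs⟩ : ∃ s, ∑ x, η x = s := ⟨_, rfl⟩
  induction s using Nat.strong_induction_on generalizing η with
  | _ s ihs =>
  obtain ⟨w, hw⟩ : ∃ w, weight η = w := ⟨_, rfl⟩
  induction w using WellFoundedLT.induction generalizing η with
  | _ w ihw =>
  by_cases hlast : η (Fin.last n) = 0
  · by_cases hex : ∃ i i' : Fin (n + 1), (i' : ℕ) = i + 1 ∧ η i' < η i
    · obtain ⟨i, i', hi, hlt⟩ := hex
      set μ : Fin (n + 1) →₀ ℕ := η.mapDomain (Equiv.swap i i') with hμ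
      have hμx : ∀ x, μ x = η (Equiv.swap i i' x) := fun x => by
        rw [hμ, Finsupp.mapDomain_equiv_apply, Equiv.symm_swap]
      have hη : (η : Fin (n + 1) → ℕ) = μ ∘ Equiv.swap i i' := by
        funext x
        rw [Function.comp, hμx, Equiv.swap_apply_self]
      have hμlt : μ i < μ i' := by
        rwa [hμx, hμx, Equiv.swap_apply_left, Equiv.swap_apply_right]
      have hlow := lower_comp_swap (by rw [Fin.lt_def]; omega) hμlt hη
      obtain ⟨E, hE, hev⟩ := ihw _ (hw ▸ hlow.weight_lt) μ (hlow.subsetDom.1.trans hs) rfl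
      have hprec : Precedes μ i' i := Or.inl ⟨by rw [Fin.lt_def]; omega, hμlt⟩
      obtain ⟨a, b, hb, hab⟩ := hprec.exists_spec_sub α
      have hδ : spec α μ i' - spec α μ i ≠ 0 := by
        rw [hab]; exact mul_natCast_add_natCast_ne_zero hα a hb
      have hδ1 : spec α μ i' - spec α μ i + 1 ≠ 0 := by
        have := mul_natCast_add_natCast_ne_zero hα a (Nat.succ_pos b)
        rw [hab, add_assoc]
        exact_mod_cast this
      refine ⟨_, hE.exchange hα hi hμlt hη hδ, ?_⟩
      have hd := d_comp_swap α hi hμlt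
      rw [← hη] at hd
      rw [map_add, eval_one_rename, smul_eval, hη, e_comp_swap α hi hμlt, ← hev, ← hη]
      apply mul_right_cancel₀ hδ1
      rw [mul_assoc, hd]
      field_simp
    · push Not at hex
      have h0 : η = 0 := by
        ext x
        induction x using Fin.reverseInduction with
        | last => exact hlast
        | cast i ih =>
          have := hex i.castSucc i.succ (by simp)
          simp only [Finsupp.coe_zero, Pi.zero_apply] at ih ⊢
          omega
      rwa [h0]
  · set μ : Fin (n + 1) →₀ ℕ :=
      (η - Finsupp.single (Fin.last n) 1).mapDomain (finRotate (n + 1)) with hμ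
    have hle : Finsupp.single (Fin.last n) 1 ≤ η := by
      rw [Finsupp.single_le_iff]; omega
    have hη : (η : Fin (n + 1) → ℕ) = raise μ := by
      rw [raise_eq, hμ, ← Finsupp.mapDomain_comp, Equiv.symm_comp_self, Finsupp.mapDomain_id,
        tsub_add_cancel_of_le hle]
    have hsum : ∑ x, μ x < s := by
      rw [← hs, hη, ← Equiv.sum_comp (finRotate (n + 1)) μ]
      refine Finset.sum_lt_sum (fun x _ => Nat.le_add_right _ _) ⟨Fin.last n, Finset.mem_univ _, ?_⟩
      simp [raise]
    obtain ⟨E, hE, hev⟩ := ihs _ hsum μ rfl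
    refine ⟨raising E, hE.raising hη, ?_⟩
    rw [eval_raising, hη, d_raise, e_raise, ← hev]
    ring

end NonsymmetricJack


/-! ### The sum of squares on symmetric polynomials -/

section SymmetricOperator

variable {N : ℕ} {K : Type*} [Field K]

theorem cherednik_of_isSymmetric (α : K) (i : Fin N) {f : MvPolynomial (Fin N) K}
    (hf : f.IsSymmetric) : cherednik α i f = α • (X i * pderiv i f) - (i : K) • f := by
  rw [cherednik_apply, Finset.sum_eq_zero, add_zero]
  intro p _
  rw [divDiff_eq_zero (hf _), mul_zero]

theorem cherednikSq_of_isSymmetric (α : K) {f : MvPolynomial (Fin N) K} (hf : f.IsSymmetric) :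
    cherednikSq α f = α ^ 2 • ∑ i, X i ^ 2 * pderiv i (pderiv i f) +
      α ^ 2 • ∑ i, X i * pderiv i f - (2 * α) • ∑ i : Fin N, (i : K) • (X i * pderiv i f) +
      α • ∑ i, ∑ p, X (max i p) * divDiff i p (X i * pderiv i f) +
      (∑ i : Fin N, (i : K) ^ 2) • f := by
  rw [cherednikSq_apply]
  simp only [Finset.smul_sum, Finset.sum_smul, ← Finset.sum_add_distrib, ← Finset.sum_sub_distrib]
  refine Finset.sum_congr rfl fun i _ => ?_
  have h1 : X i * pderiv i (X i * pderiv i f) =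
      X i * pderiv i f + X i ^ 2 * pderiv i (pderiv i f) := by
    rw [Derivation.leibniz, pderiv_X_self, smul_eq_mul, smul_eq_mul]; ring
  have h2 : ∑ p, X (max i p) * divDiff i p (α • (X i * pderiv i f) - (i : K) • f) =
      ∑ p, α • (X (max i p) * divDiff i p (X i * pderiv i f)) := by
    refine Finset.sum_congr rfl fun p _ => ?_
    rw [map_sub, map_smul, map_smul, divDiff_eq_zero (hf _), smul_zero, sub_zero, mul_smul_comm]
  rw [cherednik_of_isSymmetric α i hf, cherednik_apply, h2, map_sub, Derivation.map_smul,
    Derivation.map_smul, mul_sub, mul_smul_comm, mul_smul_comm, h1]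
  module

/-- For symmetric `f` the swap takes `z_i ∂_i f` to `z_p ∂_p f`. Writing `z_max` as `z_i` or `z_p`
in the two halves of the quotient costs `z_j ∂_j f` with `j = min i p`, which the ordered pairs
produce `2 (N - 1 - j)` times. -/
theorem sum_divDiff_eq (f : MvPolynomial (Fin N) K) (hf : f.IsSymmetric) :
    let ι := algebraMap (MvPolynomial (Fin N) K) (FractionRing (MvPolynomial (Fin N) K))
    ι (∑ i, ∑ p, X (max i p) * divDiff i p (X i * pderiv i f)) =
      2 * ∑ j, ∑ k ∈ Finset.univ.erase j,
        ι (X j ^ 2) / ι (X j - X k) * ι (pderiv j f) -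
      2 * ι (∑ i : Fin N, ((N : K) - 1 - i) • (X i * pderiv i f)) := by
  intro ι
  set Q : Fin N → Fin N → FractionRing (MvPolynomial (Fin N) K) := fun j k =>
    ι (X j ^ 2) / ι (X j - X k) * ι (pderiv j f) with hQ
  have hQ0 : ∀ j, Q j j = 0 := fun j => by simp [hQ]
  have h1 : ∀ i p, ι (X (max i p) * divDiff i p (X i * pderiv i f)) = Q i p + Q p i -
      ((if i < p then ι (X i * pderiv i f) else 0) +
        if p < i then ι (X p * pderiv p f) else 0) := by
    intro i p
    rcases eq_or_ne i p with rfl | hip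
    · simp [hQ0]
    have hne : ι (X i - X p) ≠ 0 := by
      rw [Ne, FaithfulSMul.algebraMap_eq_zero_iff]
      exact X_sub_X_ne_zero hip
    have hne' : ι (X p - X i) ≠ 0 := by
      rw [Ne, FaithfulSMul.algebraMap_eq_zero_iff]
      exact X_sub_X_ne_zero hip.symm
    have h2 : ι (divDiff i p (X i * pderiv i f)) =
        (ι (X i * pderiv i f) - ι (X p * pderiv p f)) / ι (X i - X p) := by
      rw [eq_div_iff hne, ← map_mul, mul_comm, mul_divDiff, map_mul, rename_X, rename_pderiv,
        Equiv.swap_apply_left, hf, map_sub]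
    rw [map_mul, h2, hQ]
    simp only [map_sub, map_mul, map_pow] at hne hne' ⊢
    rcases lt_or_gt_of_ne hip with h | h
    · rw [if_pos h, if_neg h.le.not_gt, max_eq_right h.le, ← neg_sub (ι (X i)) (ι (X p))]
      field_simp
      ring
    · rw [if_pos h, if_neg h.le.not_gt, max_eq_left h.le, ← neg_sub (ι (X i)) (ι (X p))]
      field_simp
      ring
  have h3 : ∀ i : Fin N, ∑ p, (if i < p then ι (X i * pderiv i f) else 0) =
      ι (((N : K) - 1 - i) • (X i * pderiv i f)) := by
    intro i
    rw [← Finset.sum_filter, Finset.sum_const, Finset.filter_lt_eq_Ioi, Fin.card_Ioi, ← map_nsmul,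
      ← Nat.cast_smul_eq_nsmul K]
    have hi := i.2
    congr 2
    rw [Nat.cast_sub (by omega), Nat.cast_sub (by omega), Nat.cast_one]
  have h4 : ∑ j, ∑ k ∈ Finset.univ.erase j, ι (X j ^ 2) / ι (X j - X k) * ι (pderiv j f) =
      ∑ j, ∑ k, Q j k := Finset.sum_congr rfl fun j _ => Finset.sum_erase _ (hQ0 j)
  rw [h4]
  simp only [map_sum, h1, Finset.sum_sub_distrib, Finset.sum_add_distrib]
  rw [Finset.sum_comm (f := fun i p => Q p i),
    Finset.sum_comm (f := fun i p => if p < i then ι (X p * pderiv p f) else 0)]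
  simp only [h3]
  ring

/-- The index-dependent terms `-2 α i z_i ∂_i` combine with those of `sum_divDiff_eq` to a multiple
of the Euler operator, which is a scalar on homogeneous polynomials. -/
theorem algebraMap_cherednikSq {α : K} (hα : α ≠ 0) {f : MvPolynomial (Fin N) K}
    (hf : f.IsSymmetric) :
    let ι := algebraMap (MvPolynomial (Fin N) K) (FractionRing (MvPolynomial (Fin N) K))
    ι (cherednikSq α f) = ι (C (α ^ 2)) * D₂ α f +
      ι ((α ^ 2 - 2 * α * (N - 1)) • ∑ i, X i * pderiv i f + (∑ i : Fin N, (i : K) ^ 2) • f) := by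
  intro ι
  have h := sum_divDiff_eq f hf
  have h1 : ι (C (α ^ 2)) * ι (C (2 / α)) = 2 * ι (C α) := by
    rw [← map_mul, ← map_mul, show (2 : FractionRing (MvPolynomial (Fin N) K)) = ι (C 2) by
      rw [map_ofNat, map_ofNat], ← map_mul, ← map_mul]
    congr 2
    field_simp
  have h2 : ∑ i : Fin N, ((N : K) - 1 - i) • (X i * pderiv i f) =
      ((N : K) - 1) • ∑ i, X i * pderiv i f - ∑ i : Fin N, (i : K) • (X i * pderiv i f) := by
    rw [Finset.smul_sum, ← Finset.sum_sub_distrib]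
    exact Finset.sum_congr rfl fun i _ => sub_smul _ _ _
  have h3 : ι (∑ i, ∑ p, X (max i p) * divDiff i p (X i * pderiv i f)) = _ := h
  rw [h2] at h3
  rw [cherednikSq_of_isSymmetric α hf, D₂, ← map_sum ι]
  simp only [map_add, map_sub, smul_eq_C_mul, map_mul] at h3 ⊢
  rw [mul_add (ι (C (α ^ 2))), ← mul_assoc (ι (C (α ^ 2))) (ι (C (2 / α))), h1]
  have h4 : ι (C 2) = 2 := by rw [map_ofNat, map_ofNat]
  rw [h4]
  linear_combination ι (C α) * h3

end SymmetricOperator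


/-! ### Monomial symmetric functions -/

section MonomialSymmetric

variable {N : ℕ} {K : Type*} [Field K]

theorem prod_map_X {σ : Type*} [DecidableEq σ] (s : Multiset σ) :
    (s.map X).prod = (monomial (Multiset.toFinsupp s) 1 : MvPolynomial σ K) := by
  induction s using Multiset.induction_on with
  | empty => simp
  | cons a s ih =>
    rw [Multiset.map_cons, Multiset.prod_cons, ih, X, monomial_mul, ← Multiset.singleton_add,
      map_add, Multiset.toFinsupp_singleton, one_mul]

theorem map_count_dedup_toMultiset (ν : Fin N →₀ ℕ) :
    (Finsupp.toMultiset ν).dedup.map (fun a => (Finsupp.toMultiset ν).count a) =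
      (Finset.univ.val.map ν).filter (· ≠ 0) := by
  rw [← Multiset.toFinset_val, Finsupp.toFinset_toMultiset, Multiset.filter_map]
  simp only [Finsupp.count_toMultiset]
  have : ν.support = Finset.univ.filter fun x => ν x ≠ 0 := by ext; simp
  rw [this, Finset.filter_val]
  rfl

/-- `Nat.Partition.ofMultiset` discards zero parts; the fixed length `N` restores them. -/
theorem filter_ne_zero_injective {M M' : Multiset ℕ} (h : M.card = M'.card)
    (h' : M.filter (· ≠ 0) = M'.filter (· ≠ 0)) : M = M' := by
  have h1 := Multiset.filter_add_not (· ≠ 0) M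
  have h2 := Multiset.filter_add_not (· ≠ 0) M'
  have h3 : ∀ L : Multiset ℕ, L.filter (fun x => ¬x ≠ 0) =
      Multiset.replicate (L.card - (L.filter (· ≠ 0)).card) 0 := by
    intro L
    rw [Multiset.eq_replicate]
    refine ⟨?_, fun b hb => by simpa using (Multiset.mem_filter.1 hb).2⟩
    conv_rhs => rw [← Multiset.filter_add_not (· ≠ 0) L]
    rw [Multiset.card_add, Multiset.filter_add]
    simp
  rw [← h1, ← h2, h3, h3, h', h]

theorem coeff_monomialSymm (μ : Fin N → ℕ) (ν : Fin N →₀ ℕ) :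
    coeff ν (monomialSymm K μ) =
      if Finset.univ.val.map ν = Finset.univ.val.map μ then 1 else 0 := by
  set M := Finset.univ.val.map μ with hM
  have hsum : (Finsupp.toMultiset ν).card = (Finset.univ.val.map ν).sum := by
    rw [Finsupp.card_toMultiset, Finsupp.sum_fintype _ _ (by simp)]
    rfl
  have hcard : (Finset.univ.val.map ν).card = M.card := by simp [hM]
  rw [monomialSymm, msymm, coeff_sum]
  simp only [prod_map_X, coeff_monomial]
  split_ifs with h
  · let t : Sym (Fin N) M.sum := Sym.mk (Finsupp.toMultiset ν) (by rw [hsum, h])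
    have ht : Nat.Partition.ofSym t = Nat.Partition.ofMultiset M := by
      rw [Nat.Partition.ext_iff]
      exact (map_count_dedup_toMultiset ν).trans (by rw [h]; rfl)
    rw [Finset.sum_eq_single ⟨t, ht⟩]
    · rw [if_pos]
      simp [t]
    · rintro ⟨s, hs⟩ - hne
      rw [if_neg]
      rintro rfl
      refine hne (Subtype.ext (Subtype.ext ?_))
      simp [t]
    · exact fun hn => absurd (Finset.mem_univ _) hn
  · refine Finset.sum_eq_zero fun s _ => if_neg ?_
    rintro rfl
    refine h (filter_ne_zero_injective hcard ?_)
    have h1 := congrArg Nat.Partition.parts s.2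
    rw [← map_count_dedup_toMultiset, Multiset.toFinsupp_toMultiset]
    exact h1

theorem exists_perm_of_map_eq {ν μ : Fin N → ℕ} (h : Finset.univ.val.map ν = Finset.univ.val.map μ) :
    ∃ g : Equiv.Perm (Fin N), ν = μ ∘ g := by
  have hc : ∀ c, Nonempty ({a // ν a = c} ≃ {a // μ a = c}) := by
    intro c
    rw [← Fintype.card_eq, Fintype.card_subtype, Fintype.card_subtype]
    have := congrArg (Multiset.count c) h
    rw [Multiset.count_map, Multiset.count_map] at this
    simpa only [eq_comm (a := c), Finset.card_def, Finset.filter_val] using this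
  exact ⟨Equiv.ofFiberEquiv fun c => (hc c).some, funext fun x => (Equiv.ofFiberEquiv_map _ x).symm⟩

theorem map_comp_perm (μ : Fin N → ℕ) (g : Equiv.Perm (Fin N)) :
    Finset.univ.val.map (μ ∘ g) = Finset.univ.val.map μ := by
  rw [← Multiset.map_map, Multiset.map_univ_val_equiv]

theorem eq_of_antitone_of_map_eq {ν μ : Fin N → ℕ} (hν : Antitone ν) (hμ : Antitone μ)
    (h : Finset.univ.val.map ν = Finset.univ.val.map μ) : ν = μ := by
  obtain ⟨g, rfl⟩ := exists_perm_of_map_eq h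
  exact Tuple.unique_antitone (f := μ) (σ := g) (τ := 1) hν hμ

theorem antitone_plus (η : Fin N → ℕ) : Antitone (plus η) := fun _ _ h =>
  Tuple.monotone_sort η (Fin.rev_le_rev.2 h)

theorem plus_eq_comp (η : Fin N → ℕ) : plus η = η ∘ (Fin.revPerm.trans (Tuple.sort η)) := rfl

theorem map_plus (η : Fin N → ℕ) : Finset.univ.val.map (plus η) = Finset.univ.val.map η := by
  rw [plus_eq_comp, map_comp_perm]

theorem coeff_eq_of_isSymmetric {f : MvPolynomial (Fin N) K} (hf : f.IsSymmetric)
    {ν μ : Fin N →₀ ℕ} (h : Finset.univ.val.map ν = Finset.univ.val.map μ) :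
    coeff ν f = coeff μ f := by
  obtain ⟨g, hg⟩ := exists_perm_of_map_eq h
  have : ν = μ.mapDomain g.symm := by
    ext x
    rw [Finsupp.mapDomain_equiv_apply, hg]; simp
  rw [this, ← coeff_rename_perm, hf]

theorem isSymmetric_monomialSymm (μ : Fin N → ℕ) : (monomialSymm K μ).IsSymmetric :=
  msymm_isSymmetric _ _ _

open scoped Classical in
theorem isSymmetric_eq_sum {f : MvPolynomial (Fin N) K} (hf : f.IsSymmetric) :
    f = ∑ μ ∈ f.support.filter (fun μ : Fin N →₀ ℕ => Antitone (⇑μ : Fin N → ℕ)), coeff μ f • monomialSymm K μ := by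
  ext ν
  rw [coeff_sum]
  simp only [coeff_smul, coeff_monomialSymm, smul_eq_mul, mul_ite, mul_one, mul_zero]
  set μ : Fin N →₀ ℕ := Finsupp.equivFunOnFinite.symm (plus ν) with hμ
  have hμ' : (μ : Fin N → ℕ) = plus ν := rfl
  have h1 : Finset.univ.val.map ν = Finset.univ.val.map μ := by rw [hμ', map_plus]
  have h2 := coeff_eq_of_isSymmetric hf h1
  rw [h2, Finset.sum_eq_single μ]
  · rw [if_pos h1]
  · intro κ hκ hne
    rw [if_neg]
    intro h3
    refine hne (DFunLike.coe_injective (eq_of_antitone_of_map_eq (Finset.mem_filter.1 hκ).2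
      (hμ' ▸ antitone_plus _) (h3.symm.trans h1)))
  · intro hn
    rw [Finset.mem_filter, mem_support_iff] at hn
    rw [if_pos h1]
    by_contra h3
    exact hn ⟨h3, hμ' ▸ antitone_plus _⟩

end MonomialSymmetric


/-! ### Arms and legs of sorted compositions -/

section Ties

variable {N : ℕ} {M : Type*} [CommMonoid M]

theorem prod_card_filter_lt {ι : Type*} [LinearOrder ι] (S : Finset ι) (g : ℕ → M) :
    ∏ i ∈ S, g (S.filter (· < i)).card = ∏ r ∈ Finset.range S.card, g r := by
  induction S using Finset.induction_on_max with
  | empty => simp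
  | insert a s ha ih =>
    have has : a ∉ s := fun h => lt_irrefl a (ha a h)
    rw [Finset.prod_insert has, Finset.card_insert_of_notMem has, Finset.prod_range_succ, ← ih,
      mul_comm]
    congr 1
    · refine Finset.prod_congr rfl fun x hx => ?_
      rw [Finset.filter_insert, if_neg (ha x hx).not_gt]
    · rw [Finset.filter_insert, if_neg (lt_irrefl a), Finset.filter_true_of_mem ha]

theorem prod_card_filter_gt {ι : Type*} [LinearOrder ι] (S : Finset ι) (g : ℕ → M) :
    ∏ i ∈ S, g (S.filter (i < ·)).card = ∏ r ∈ Finset.range S.card, g r :=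
  prod_card_filter_lt (ι := ιᵒᵈ) S g

/-- The number of earlier entries equal to the entry in position `i`. -/
def tiesBefore (η : Fin N → ℕ) (i : Fin N) : ℕ :=
  (Finset.univ.filter fun k => k < i ∧ η k = η i).card

/-- The number of later entries equal to the entry in position `i`. -/
def tiesAfter (η : Fin N → ℕ) (i : Fin N) : ℕ :=
  (Finset.univ.filter fun k => i < k ∧ η k = η i).card

/-- Within a level set the ranks run through `0, …, f_b - 1`, so the product does not depend on the
arrangement of the entries. -/
theorem prod_tiesBefore (η : Fin N → ℕ) {B : ℕ} (hB : ∀ i, η i < B) (F : ℕ → ℕ → M) :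
    ∏ i, F (η i) (tiesBefore η i) = ∏ b ∈ Finset.range B, ∏ r ∈ Finset.range (freq η b), F b r := by
  rw [← Finset.prod_fiberwise_of_maps_to (g := η) (t := Finset.range B)
    fun i _ => Finset.mem_range.2 (hB i)]
  refine Finset.prod_congr rfl fun b _ => ?_
  rw [freq, ← prod_card_filter_lt]
  refine Finset.prod_congr rfl fun i hi => ?_
  have hi' := (Finset.mem_filter.1 hi).2
  rw [tiesBefore, hi', Finset.filter_filter]
  simp only [and_comm]

theorem prod_tiesAfter (η : Fin N → ℕ) {B : ℕ} (hB : ∀ i, η i < B) (F : ℕ → ℕ → M) :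
    ∏ i, F (η i) (tiesAfter η i) = ∏ b ∈ Finset.range B, ∏ r ∈ Finset.range (freq η b), F b r := by
  rw [← Finset.prod_fiberwise_of_maps_to (g := η) (t := Finset.range B)
    fun i _ => Finset.mem_range.2 (hB i)]
  refine Finset.prod_congr rfl fun b _ => ?_
  rw [freq, ← prod_card_filter_gt]
  refine Finset.prod_congr rfl fun i hi => ?_
  have hi' := (Finset.mem_filter.1 hi).2
  rw [tiesAfter, hi', Finset.filter_filter]
  simp only [and_comm]

theorem card_filter_comp_perm (η : Fin N → ℕ) (g : Equiv.Perm (Fin N)) (p : ℕ → Prop)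
    [DecidablePred p] : (Finset.univ.filter fun k => p ((η ∘ g) k)).card =
      (Finset.univ.filter fun k => p (η k)).card :=
  Finset.card_equiv g fun x => by simp

theorem freq_comp_perm (η : Fin N → ℕ) (g : Equiv.Perm (Fin N)) (b : ℕ) :
    freq (η ∘ g) b = freq η b := card_filter_comp_perm η g (· = b)

theorem lt_sup_succ (η : Fin N → ℕ) (i : Fin N) : η i < Finset.univ.sup η + 1 :=
  Nat.lt_succ_of_le (Finset.le_sup (Finset.mem_univ i))

theorem prod_tiesBefore_comp_perm (η : Fin N → ℕ) (g : Equiv.Perm (Fin N)) (F : ℕ → ℕ → M) :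
    ∏ i, F ((η ∘ g) i) (tiesBefore (η ∘ g) i) = ∏ i, F (η i) (tiesBefore η i) := by
  rw [prod_tiesBefore η (lt_sup_succ η), prod_tiesBefore (η ∘ g) fun i => lt_sup_succ η (g i)]
  simp only [freq_comp_perm]

theorem prod_tiesAfter_comp_perm (η : Fin N → ℕ) (g : Equiv.Perm (Fin N)) (F : ℕ → ℕ → M) :
    ∏ i, F ((η ∘ g) i) (tiesAfter (η ∘ g) i) = ∏ i, F (η i) (tiesAfter η i) := by
  rw [prod_tiesAfter η (lt_sup_succ η), prod_tiesAfter (η ∘ g) fun i => lt_sup_succ η (g i)]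
  simp only [freq_comp_perm]

/-- The number of entries of `η` in the interval `[j, c)`. -/
def countBetween (η : Fin N → ℕ) (j c : ℕ) : ℕ := (Finset.univ.filter fun k => j ≤ η k ∧ η k < c).card

theorem countBetween_comp_perm (η : Fin N → ℕ) (g : Equiv.Perm (Fin N)) (j c : ℕ) :
    countBetween (η ∘ g) j c = countBetween η j c :=
  card_filter_comp_perm η g fun x => j ≤ x ∧ x < c

theorem coleg_eq_add_tiesBefore (η : Fin N → ℕ) (i : Fin N) :
    coleg η i = (Finset.univ.filter fun k => η i < η k).card + tiesBefore η i := by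
  rw [coleg, tiesBefore, ← Finset.card_union_of_disjoint, ← Finset.card_union_of_disjoint,
    ← Finset.filter_or, ← Finset.filter_or]
  · congr 1
    ext k
    simp only [Finset.mem_filter, Finset.mem_univ, true_and]
    rcases lt_trichotomy i k with h | rfl | h
    · simp [h, h.le.not_gt]
    · simp
    · simp only [h, h.le.not_gt, true_and, false_and, false_or]; omega
  · rw [Finset.disjoint_filter]; intro k _ h1 h2; omega
  · rw [Finset.disjoint_filter]; exact fun k _ h1 h2 => absurd h1.1 h2.1.not_gt

theorem coleg_of_antitone {κ : Fin N → ℕ} (hκ : Antitone κ) (i : Fin N) : coleg κ i = i := by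
  have h1 : (Finset.univ.filter fun k => i < k ∧ κ i < κ k) = ∅ :=
    Finset.filter_eq_empty_iff.2 fun k _ h => absurd (hκ h.1.le) h.2.not_ge
  have h2 : (Finset.univ.filter fun k => k < i ∧ κ i ≤ κ k) = Finset.Iio i := by
    ext k
    simpa using fun h : k < i => hκ h.le
  rw [coleg, h1, h2, Fin.card_Iio]; simp

theorem leg_of_antitone {κ : Fin N → ℕ} (hκ : Antitone κ) {i : Fin N} {j : ℕ} (hj : j ≤ κ i) :
    leg κ i j = tiesAfter κ i + countBetween κ j (κ i) := by
  have h1 : (Finset.univ.filter fun k => k < i ∧ j ≤ κ k + 1 ∧ κ k + 1 ≤ κ i) = ∅ :=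
    Finset.filter_eq_empty_iff.2 fun k _ h => by have := hκ h.1.le; omega
  rw [leg, h1, Finset.card_empty, add_zero, tiesAfter, countBetween,
    ← Finset.card_union_of_disjoint, ← Finset.filter_or]
  · congr 1
    ext k
    simp only [Finset.mem_filter, Finset.mem_univ, true_and]
    rcases le_or_gt k i with h | h
    · have := hκ h
      have h' := h.not_gt
      simp only [h', false_and, false_or, false_iff]
      omega
    · simp only [h, true_and]
      omega
  · rw [Finset.disjoint_filter]; intro k _ h1 h2; omega

/-- Shorter rows now lie above, where one extra column is allowed. Hence column `j + 1` counts the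
entries in `[j, ρ i)`, whereas for a decreasing sequence it counts those in `[j + 1, κ i)`; this
shift relates `d` of `ηᴿ` to `h` of `η⁺`. -/
theorem leg_of_monotone {ρ : Fin N → ℕ} (hρ : Monotone ρ) {i : Fin N} {j : ℕ} (hj : j < ρ i) :
    leg ρ i (j + 1) = tiesAfter ρ i + countBetween ρ j (ρ i) := by
  rw [leg, tiesAfter, countBetween]
  congr 2
  · ext k
    simp only [Finset.mem_filter, Finset.mem_univ, true_and]
    refine and_congr_right fun h => ?_
    have := hρ h.le
    omega
  · ext k
    simp only [Finset.mem_filter, Finset.mem_univ, true_and]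
    rcases lt_or_ge k i with h | h
    · simp only [h, true_and]; omega
    · have := hρ h
      simp only [h.not_gt, false_and, false_iff]
      omega

theorem tiesAfter_add_countBetween {κ : Fin N → ℕ} (hκ : Antitone κ) (i : Fin N) :
    tiesAfter κ i + countBetween κ 0 (κ i) + 1 + i = N := by
  have h : tiesAfter κ i + countBetween κ 0 (κ i) = (Finset.Ioi i).card := by
    rw [tiesAfter, countBetween, ← Finset.card_union_of_disjoint, ← Finset.filter_or]
    · congr 1
      ext k
      simp only [Finset.mem_filter, Finset.mem_univ, true_and, Finset.mem_Ioi]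
      rcases le_or_gt k i with h | h
      · have := hκ h
        simp only [h.not_gt, false_and, false_or, iff_false]
        omega
      · have := hκ h.le
        simp only [h, true_and, iff_true]
        omega
    · rw [Finset.disjoint_filter]; intro k _ h1 h2; omega
  rw [h, Fin.card_Ioi]
  have := i.2
  omega

end Ties

/-! ### Equality of the two product formulas -/

section HookIdentity

variable {N : ℕ} {K : Type*} [Field K]

theorem prod_Icc_eq_prod_range {M : Type*} [CommMonoid M] (f : ℕ → M) (m : ℕ) :
    ∏ j ∈ Finset.Icc 1 m, f j = ∏ j ∈ Finset.range m, f (j + 1) := by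
  rw [Finset.range_eq_Ico, Finset.prod_Ico_add' f 0 m 1]
  rfl

theorem e_comp_perm (α : K) (η : Fin N → ℕ) (g : Equiv.Perm (Fin N)) : e α (η ∘ g) = e α η := by
  have h := prod_tiesBefore_comp_perm η g fun c r => ∏ j ∈ Finset.Icc 1 c,
    (α * ((coarm j : K) + 1) + (N : K) -
      ((Finset.univ.filter fun k => c < η k).card + r : ℕ))
  have hc : ∀ c, (Finset.univ.filter fun k => c < η (g k)).card =
      (Finset.univ.filter fun k => c < η k).card := fun c => card_filter_comp_perm η g (c < ·)
  rw [e, e]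
  simp only [coleg_eq_add_tiesBefore, Function.comp_apply, hc] at h ⊢
  exact h

/-- In row `i` the factors of `e` are those of `b` moved by one column. The ends are `N - i`, with
product `N!`, and `α κ_i + N - i`. -/
theorem factorial_mul_e (α : K) {κ : Fin N → ℕ} (hκ : Antitone κ) :
    (N.factorial : K) * e α κ = b α κ * ∏ i, (α * κ i + N - (i : ℕ)) := by
  have h1 : (N.factorial : K) = ∏ i : Fin N, ((N : K) - (i : ℕ)) := by
    rw [Fin.prod_univ_eq_prod_range (fun i => (N : K) - i), ← Finset.prod_range_add_one_eq_factorial,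
      ← Finset.prod_range_reflect, Nat.cast_prod]
    refine Finset.prod_congr rfl fun i hi => ?_
    rw [Finset.mem_range] at hi
    rw [← Nat.cast_sub hi.le]
    congr 1; omega
  rw [h1, e, b, ← Finset.prod_mul_distrib, ← Finset.prod_mul_distrib]
  refine Finset.prod_congr rfl fun i _ => ?_
  have h2 := Finset.prod_range_succ (fun j : ℕ => α * (j : K) + N - (i : ℕ)) (κ i)
  rw [Finset.prod_range_succ'] at h2
  simp only [prod_Icc_eq_prod_range, coarm, Nat.add_sub_cancel, coleg_of_antitone hκ]
  rw [← h2]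
  push_cast
  ring

theorem h_mul_prod (α : K) (η : Fin N → ℕ) :
    h α (plus η) * ∏ i, (α * plus η i + N - (i : ℕ)) =
      (∏ j ∈ Finset.range (Finset.univ.sup (plus η) + 1), ((freq (plus η) j).factorial : K)) *
        d α (rev η) := by
  have hκ : Antitone (plus η) := fun _ _ h => Tuple.monotone_sort η (Fin.rev_le_rev.2 h)
  have hρ : Monotone (rev η) := fun _ _ h => hκ (Fin.rev_le_rev.2 h)
  have hρκ : rev η = plus η ∘ Fin.revPerm := rfl
  set κ := plus η
  -- The row product of `d` for a row of length `c` with `r` later ties. The column is `j + 1`, so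
  -- `c - j` is the arm plus one.
  let G : ℕ → ℕ → K := fun c r => ∏ j ∈ Finset.range c,
    (α * ((c - j : ℕ) : K) + (r + countBetween κ j c : ℕ) + 1)
  have hd : d α (rev η) = ∏ i, G (κ i) (tiesAfter κ i) := by
    rw [← prod_tiesAfter_comp_perm κ Fin.revPerm G, ← hρκ, d]
    refine Finset.prod_congr rfl fun i _ => ?_
    rw [prod_Icc_eq_prod_range]
    refine Finset.prod_congr rfl fun j hj => ?_
    rw [Finset.mem_range] at hj
    rw [leg_of_monotone hρ hj, hρκ, countBetween_comp_perm, ← hρκ, arm, ← Nat.cast_succ]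
    congr 4
    omega
  have hf : (∏ j ∈ Finset.range (Finset.univ.sup κ + 1), ((freq κ j).factorial : K)) =
      ∏ i, ((tiesAfter κ i : K) + 1) := by
    rw [prod_tiesAfter κ (lt_sup_succ κ) fun _ r => (r : K) + 1]
    refine Finset.prod_congr rfl fun j _ => ?_
    rw [← Finset.prod_range_add_one_eq_factorial]
    push_cast; rfl
  rw [hd, hf, h, ← Finset.prod_mul_distrib, ← Finset.prod_mul_distrib]
  refine Finset.prod_congr rfl fun i _ => ?_
  -- The product over `0 ≤ j ≤ κ i` is split at either end. Without `j = 0`, whose factor is `α κ_i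
  -- + N - i`, it is the row of `h`; without `j = κ i`, whose factor is `tiesAfter κ i + 1`, it is
  -- the row of `d`.
  have h1 := Finset.prod_range_succ (fun j : ℕ =>
    α * ((κ i - j : ℕ) : K) + (tiesAfter κ i + countBetween κ j (κ i) : ℕ) + 1) (κ i)
  rw [Finset.prod_range_succ'] at h1
  have h2 : (N : K) = (tiesAfter κ i + countBetween κ 0 (κ i) : ℕ) + 1 + (i : ℕ) := by
    exact_mod_cast congrArg (Nat.cast (R := K)) (tiesAfter_add_countBetween hκ i).symm
  have h3 : countBetween κ (κ i) (κ i) = 0 := by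
    rw [countBetween, Finset.card_eq_zero, Finset.filter_eq_empty_iff]
    intro k _ h; omega
  have h4 : ∏ j ∈ Finset.Icc 1 (κ i), (α * (arm κ i j : K) + (leg κ i j : K) + 1) =
      ∏ j ∈ Finset.range (κ i), (α * ((κ i - (j + 1) : ℕ) : K) +
        (tiesAfter κ i + countBetween κ (j + 1) (κ i) : ℕ) + 1) := by
    rw [prod_Icc_eq_prod_range]
    refine Finset.prod_congr rfl fun j hj => ?_
    rw [leg_of_antitone hκ (Finset.mem_range.1 hj), arm]
  rw [h3, Nat.sub_self, Nat.sub_zero] at h1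
  rw [h4, h2]
  calc _ = _ := by ring
    _ = _ := h1
    _ = _ := by simp only [G]; push_cast; ring

end HookIdentity


/-! ### Consequences of dominance -/

section Dominance

variable {N : ℕ}

/-- Abel summation: split off the last value of `g` as a constant and recurse on the shorter
sequence. -/
theorem sum_mul_nonneg_of_antitone_of_nonneg : ∀ {n : ℕ} {g x : Fin n → ℤ}, Antitone g →
    (∀ i, 0 ≤ g i) → (∀ p, 0 ≤ ∑ i ∈ Finset.Iic p, x i) → 0 ≤ ∑ i, g i * x i
  | 0, _, _, _, _, _ => by simp
  | n + 1, g, x, hg, h0, hx => by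
    have h1 : 0 ≤ ∑ i : Fin n, (g i.castSucc - g (Fin.last n)) * x i.castSucc := by
      refine sum_mul_nonneg_of_antitone_of_nonneg
        (fun i j h => sub_le_sub_right (hg (Fin.castSucc_le_castSucc_iff.2 h)) _)
        (fun i => sub_nonneg.2 (hg (Fin.le_last _))) fun p => ?_
      have := hx p.castSucc
      rwa [← Fin.map_castSuccEmb_Iic, Finset.sum_map] at this
    have h2 := hx (Fin.last n)
    rw [show Finset.Iic (Fin.last n) = Finset.univ by ext i; simp [Fin.le_last]] at h2
    have h3 := mul_nonneg (h0 (Fin.last n)) h2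
    rw [Fin.sum_univ_castSucc] at h3 ⊢
    simp only [sub_mul, Finset.sum_sub_distrib, ← Finset.mul_sum] at h1
    linarith

theorem sum_mul_nonneg_of_antitone {g x : Fin N → ℤ} (hg : Antitone g) (h0 : ∑ i, x i = 0)
    (hx : ∀ p, 0 ≤ ∑ i ∈ Finset.Iic p, x i) : 0 ≤ ∑ i, g i * x i := by
  rcases N with _ | n
  · simp
  have h := sum_mul_nonneg_of_antitone_of_nonneg (g := fun i => g i - g (Fin.last n))
    (fun i j h => sub_le_sub_right (hg h) _) (fun i => sub_nonneg.2 (hg (Fin.le_last _))) hx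
  simp only [sub_mul, Finset.sum_sub_distrib, ← Finset.mul_sum, h0, mul_zero, sub_zero] at h
  exact h

theorem DomLT.sum_mul_le {μ κ : Fin N → ℕ} (h : DomLT μ κ) {g : Fin N → ℤ} (hg : Antitone g) :
    ∑ i, g i * μ i ≤ ∑ i, g i * κ i := by
  have := sum_mul_nonneg_of_antitone (x := fun i => (κ i : ℤ) - μ i) hg
    (by rw [Finset.sum_sub_distrib, sub_eq_zero]; exact_mod_cast h.2.1.symm)
    (fun p => by rw [Finset.sum_sub_distrib, sub_nonneg]; exact_mod_cast h.2.2 p)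
  simp only [mul_sub, Finset.sum_sub_distrib] at this
  linarith

theorem DomLT.sum_id_mul_le {μ κ : Fin N → ℕ} (h : DomLT μ κ) :
    ∑ i : Fin N, (i : ℕ) * κ i ≤ ∑ i : Fin N, (i : ℕ) * μ i := by
  have := h.sum_mul_le (g := fun i => -((i : ℕ) : ℤ)) fun i j h => by simpa using h
  simp only [neg_mul, Finset.sum_neg_distrib, neg_le_neg_iff] at this
  exact_mod_cast this

/-- Dominance tested against the decreasing sequence `μ` gives `∑ μ² ≤ ∑ μ κ`; combine this with `∑
(κ - μ)² > 0`. -/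
theorem DomLT.sum_sq_lt {μ κ : Fin N → ℕ} (h : DomLT μ κ) (hμ : Antitone μ) :
    ∑ i, μ i ^ 2 < ∑ i, κ i ^ 2 := by
  have h1 := h.sum_mul_le (g := fun i => (μ i : ℤ)) fun i j h => by simpa using hμ h
  have h2 : 0 < ∑ i, ((κ i : ℤ) - μ i) ^ 2 := by
    obtain ⟨i, hi⟩ := Function.ne_iff.1 h.1
    refine Finset.sum_pos' (fun i _ => sq_nonneg _) ⟨i, Finset.mem_univ i, ?_⟩
    have : (κ i : ℤ) - μ i ≠ 0 := fun h => hi (by omega)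
    positivity
  have h3 : ∑ i, ((κ i : ℤ) - μ i) ^ 2 = ∑ i, (κ i : ℤ) ^ 2 + ∑ i, (μ i : ℤ) ^ 2 -
      2 * ∑ i, (μ i : ℤ) * κ i := by
    rw [Finset.mul_sum, ← Finset.sum_add_distrib, ← Finset.sum_sub_distrib]
    exact Finset.sum_congr rfl fun i _ => by ring
  have h4 : ∑ i, (μ i : ℤ) * μ i = ∑ i, (μ i : ℤ) ^ 2 := by simp only [sq]
  have : ∑ i, (μ i : ℤ) ^ 2 < ∑ i, (κ i : ℤ) ^ 2 := by linarith
  exact_mod_cast this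

theorem sum_le_sum_Iic_of_antitone {κ : Fin N → ℕ} (hκ : Antitone κ) {p : Fin N}
    {S : Finset (Fin N)} (hS : S.card = (Finset.Iic p).card) :
    ∑ i ∈ S, κ i ≤ ∑ i ∈ Finset.Iic p, κ i := by
  rw [← Finset.sum_inter_add_sum_sdiff S (Finset.Iic p), ← Finset.sum_inter_add_sum_sdiff (Finset.Iic p) S,
    Finset.inter_comm]
  refine Nat.add_le_add_left ?_ _
  calc ∑ i ∈ S \ Finset.Iic p, κ i ≤ (S \ Finset.Iic p).card • κ p := by
        refine Finset.sum_le_card_nsmul _ _ _ fun i hi => hκ ?_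
        rw [Finset.mem_sdiff, Finset.mem_Iic, not_le] at hi
        exact hi.2.le
    _ = (Finset.Iic p \ S).card • κ p := by rw [Finset.card_sdiff_comm hS]
    _ ≤ _ := by
        refine Finset.card_nsmul_le_sum _ _ _ fun i hi => hκ ?_
        rw [Finset.mem_sdiff, Finset.mem_Iic] at hi
        exact hi.1

theorem SubsetDom.domLT {ν κ : Fin N → ℕ} (h : SubsetDom ν κ) (hκ : Antitone κ) (hne : ν ≠ κ) :
    DomLT ν κ := by
  refine ⟨hne, h.1, fun p => ?_⟩
  obtain ⟨S, hS, hle⟩ := h.2 (Finset.Iic p)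
  exact hle.trans (sum_le_sum_Iic_of_antitone hκ hS)

theorem subsetDom_comp_perm (κ : Fin N → ℕ) (g : Equiv.Perm (Fin N)) : SubsetDom (κ ∘ g) κ :=
  ⟨Equiv.sum_comp g κ, fun S => ⟨S.map g.toEmbedding, Finset.card_map _, by simp⟩⟩

end Dominance

/-! ### Eigenvalues on symmetric polynomials -/

section Eigenvalues

variable {N : ℕ} {K : Type*} [Field K] {α : K}

theorem sum_spec_sq_of_antitone (α : K) {κ : Fin N → ℕ} (hκ : Antitone κ) :
    ∑ i, spec α κ i ^ 2 = α ^ 2 * (∑ i, κ i ^ 2 : ℕ) - 2 * α * (∑ i : Fin N, (i : ℕ) * κ i : ℕ) +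
      ∑ i : Fin N, ((i : ℕ) : K) ^ 2 := by
  push_cast
  rw [Finset.mul_sum, Finset.mul_sum, ← Finset.sum_sub_distrib, ← Finset.sum_add_distrib]
  refine Finset.sum_congr rfl fun i _ => ?_
  rw [spec, coleg_of_antitone hκ]
  ring

/-- The two sides differ by `α (α (a + 1) + 2 c)`, where `a + 1 = ∑ κ_i² - ∑ μ_i²` and `c = ∑ i μ_i
- ∑ i κ_i ≥ 0`. -/
theorem DomLT.sum_spec_sq_ne [CharZero K] (hα : ∀ q : ℚ, q ≤ 0 → α ≠ (q : K)) {μ κ : Fin N → ℕ}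
    (h : DomLT μ κ) (hμ : Antitone μ) (hκ : Antitone κ) :
    ∑ i, spec α μ i ^ 2 ≠ ∑ i, spec α κ i ^ 2 := by
  intro he
  have h0 : α ≠ 0 := by simpa using hα 0 le_rfl
  rw [sum_spec_sq_of_antitone α hμ, sum_spec_sq_of_antitone α hκ] at he
  obtain ⟨a, ha⟩ := Nat.exists_eq_add_of_lt (h.sum_sq_lt hμ)
  obtain ⟨c, hc⟩ := Nat.exists_eq_add_of_le h.sum_id_mul_le
  rw [ha, hc] at he
  have h1 : α * ((a + 1 : ℕ) : K) + (2 * c : ℕ) = 0 := by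
    apply (mul_eq_zero.1 _).resolve_left h0
    push_cast at he ⊢
    linear_combination -he
  rcases Nat.eq_zero_or_pos c with rfl | hc
  · rw [mul_zero, Nat.cast_zero, add_zero] at h1
    exact (mul_ne_zero h0 (Nat.cast_ne_zero.2 a.succ_ne_zero)) h1
  · exact mul_natCast_add_natCast_ne_zero hα (a + 1) (by omega : 0 < 2 * c) h1

/-- A heaviest exponent is decreasing, since otherwise symmetry would yield a heavier one by
exchanging two entries. By triangularity each `ξ_i` acts on its coefficient as a scalar, also when
applied a second time. -/
theorem exists_antitone_of_cherednikSq_eq {f : MvPolynomial (Fin N) K} (hf : f.IsSymmetric)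
    (h0 : f ≠ 0) {c : K} (hc : cherednikSq α f = c • f) :
    ∃ ν ∈ f.support, Antitone (⇑ν : Fin N → ℕ) ∧ (∀ μ ∈ f.support, weight μ ≤ weight ν) ∧
      c = ∑ i, spec α ν i ^ 2 := by
  obtain ⟨ν, hν, hmax⟩ := f.support.exists_max_image weight (support_nonempty.2 h0)
  refine ⟨ν, hν, ?_, hmax, ?_⟩
  · intro i i' hle
    by_contra hlt
    rw [not_le] at hlt
    have hne : i ≠ i' := by rintro rfl; exact lt_irrefl _ hlt
    set μ : Fin N →₀ ℕ := Finsupp.equivFunOnFinite.symm (ν ∘ Equiv.swap i i') with hμ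
    have hμ' : (μ : Fin N → ℕ) = ν ∘ Equiv.swap i i' := rfl
    have h1 := lower_comp_swap (lt_of_le_of_ne hle hne) hlt hμ'
    refine absurd h1.weight_lt (hmax μ ?_).not_gt
    rw [mem_support_iff] at hν ⊢
    rwa [coeff_eq_of_isSymmetric hf (ν := μ) (μ := ν)]
    rw [hμ', map_comp_perm]
  · have h1 : ∀ g : MvPolynomial (Fin N) K, (g.support : Set (Fin N →₀ ℕ)) ⊆ {μ | weight μ ≤ weight ν} →
        ∀ i, coeff ν (cherednik α i g) = spec α ν i * coeff ν g := fun g hg i =>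
      coeff_cherednik α i fun μ hμ hl => absurd hl.weight_lt (hg hμ).not_gt
    have h2 : ∀ i, ((cherednik α i f).support : Set (Fin N →₀ ℕ)) ⊆ {μ | weight μ ≤ weight ν} := fun i =>
      support_cherednik_subset α i (G := {μ | weight μ ≤ weight ν})
        (fun μ hμ ν hl => hl.weight_lt.le.trans hμ) hmax
    have h3 := congrArg (coeff ν) hc
    rw [cherednikSq_apply, coeff_sum, coeff_smul, smul_eq_mul] at h3
    simp only [h1 _ (h2 _), h1 f hmax] at h3
    rw [mem_support_iff] at hν
    apply mul_right_cancel₀ hν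
    rw [← h3, Finset.sum_mul]
    exact Finset.sum_congr rfl fun i _ => by ring

end Eigenvalues

/-! ### Uniqueness of the symmetric Jack polynomial -/

section Uniqueness

variable {N : ℕ} {K : Type*} [Field K] {α : K}

theorem D₂_eq_of_cherednikSq_eq (hα : α ≠ 0) {f : MvPolynomial (Fin N) K} (hf : f.IsSymmetric)
    {s : ℕ} (hs : f.IsHomogeneous s) {c : K} (hc : cherednikSq α f = c • f) :
    ∃ c : K, D₂ α f = algebraMap (MvPolynomial (Fin N) K) _ (C c * f) := by
  have h := algebraMap_cherednikSq hα hf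
  have hne : C (α ^ 2) ≠ (0 : MvPolynomial (Fin N) K) := by simpa using hα
  refine ⟨(α ^ 2)⁻¹ * (c - ((α ^ 2 - 2 * α * (N - 1)) * s + ∑ i : Fin N, (i : K) ^ 2)), ?_⟩
  dsimp only at h
  rw [hc, hs.sum_X_mul_pderiv, ← sub_eq_iff_eq_add, ← map_sub] at h
  have hne' : algebraMap (MvPolynomial (Fin N) K) (FractionRing (MvPolynomial (Fin N) K))
      (C (α ^ 2)) ≠ 0 := by rwa [Ne, FaithfulSMul.algebraMap_eq_zero_iff]
  apply mul_left_cancel₀ hne'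
  rw [← h, ← map_mul, ← mul_assoc, ← C_mul, mul_inv_cancel_left₀ (pow_ne_zero 2 hα),
    ← Nat.cast_smul_eq_nsmul K, ← smul_eq_C_mul]
  congr 1
  module

theorem cherednikSq_eq_of_D₂_eq (hα : α ≠ 0) {f : MvPolynomial (Fin N) K} (hf : f.IsSymmetric)
    {s : ℕ} (hs : f.IsHomogeneous s) {c : K}
    (hc : D₂ α f = algebraMap (MvPolynomial (Fin N) K) _ (C c * f)) :
    ∃ c : K, cherednikSq α f = c • f := by
  have h := algebraMap_cherednikSq hα hf
  dsimp only at h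
  rw [hc, hs.sum_X_mul_pderiv, ← map_mul, ← map_add] at h
  refine ⟨α ^ 2 * c + ((α ^ 2 - 2 * α * (N - 1)) * s + ∑ i : Fin N, (i : K) ^ 2), ?_⟩
  rw [FaithfulSMul.algebraMap_injective _ _ h, ← Nat.cast_smul_eq_nsmul K, ← mul_assoc, ← C_mul,
    ← smul_eq_C_mul]
  module

theorem exists_domLT_of_mem_span {κ : Fin N → ℕ} {f : MvPolynomial (Fin N) K}
    (hf : f ∈ Submodule.span K
      {m | ∃ μ : Fin N → ℕ, Antitone μ ∧ DomLT μ κ ∧ m = monomialSymm K μ})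
    {ν : Fin N →₀ ℕ} (hν : ν ∈ f.support) :
    ∃ μ : Fin N → ℕ, Antitone μ ∧ DomLT μ κ ∧ Finset.univ.val.map ν = Finset.univ.val.map μ := by
  have h : Submodule.span K
      {m | ∃ μ : Fin N → ℕ, Antitone μ ∧ DomLT μ κ ∧ m = monomialSymm K μ} ≤
      restrictSupport K {ν : Fin N →₀ ℕ | ∃ μ : Fin N → ℕ, Antitone μ ∧ DomLT μ κ ∧
        Finset.univ.val.map ν = Finset.univ.val.map μ} := by
    rw [Submodule.span_le]
    rintro _ ⟨μ, hμ, hd, rfl⟩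
    rw [SetLike.mem_coe, mem_restrictSupport_iff]
    intro ν hν
    rw [Finset.mem_coe, mem_support_iff, coeff_monomialSymm] at hν
    exact ⟨μ, hμ, hd, by by_contra hn; exact hν (if_neg hn)⟩
  exact ((mem_restrictSupport_iff K).1 (h hf)) hν

theorem sum_eq_of_map_eq {ν μ : Fin N → ℕ} (h : Finset.univ.val.map ν = Finset.univ.val.map μ) :
    ∑ i, ν i = ∑ i, μ i := congrArg Multiset.sum h

theorem isHomogeneous_of_sum_eq {f : MvPolynomial (Fin N) K} {s : ℕ}
    (h : ∀ ν ∈ f.support, ∑ i, ν i = s) : f.IsHomogeneous s := by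
  intro ν hν
  rw [← h ν (mem_support_iff.2 hν), Finsupp.weight_apply, Finsupp.sum_fintype _ _ (by simp)]
  simp

namespace IsSymmetricJack

variable {κ : Fin N → ℕ} {P P' : MvPolynomial (Fin N) K}

theorem exists_of_mem_support (h : IsSymmetricJack α κ P) (hκ : Antitone κ) {ν : Fin N →₀ ℕ}
    (hν : ν ∈ P.support) : ∃ μ : Fin N → ℕ, Antitone μ ∧ (μ = κ ∨ DomLT μ κ) ∧
      Finset.univ.val.map ν = Finset.univ.val.map μ := by
  by_cases h1 : Finset.univ.val.map ν = Finset.univ.val.map κ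
  · exact ⟨κ, hκ, Or.inl rfl, h1⟩
  · have h2 : ν ∈ (P - monomialSymm K κ).support := by
      rw [mem_support_iff] at hν ⊢
      rwa [coeff_sub, coeff_monomialSymm, if_neg h1, sub_zero]
    obtain ⟨μ, hμ, hd, he⟩ := exists_domLT_of_mem_span h.2.2 h2
    exact ⟨μ, hμ, Or.inr hd, he⟩

theorem isHomogeneous (h : IsSymmetricJack α κ P) (hκ : Antitone κ) :
    P.IsHomogeneous (∑ i, κ i) := by
  refine isHomogeneous_of_sum_eq fun ν hν => ?_
  obtain ⟨μ, -, h1, h2⟩ := h.exists_of_mem_support hκ hν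
  rw [sum_eq_of_map_eq h2]
  rcases h1 with rfl | h1
  · rfl
  · exact h1.2.1

theorem coeff_eq_one (h : IsSymmetricJack α κ P) (hκ : Antitone κ) :
    coeff (Finsupp.equivFunOnFinite.symm κ) P = 1 := by
  set κ' : Fin N →₀ ℕ := Finsupp.equivFunOnFinite.symm κ
  have hκ' : (κ' : Fin N → ℕ) = κ := rfl
  have h1 : coeff κ' (P - monomialSymm K κ) = 0 := by
    by_contra hn
    obtain ⟨μ, hμ, hd, he⟩ := exists_domLT_of_mem_span h.2.2 (mem_support_iff.2 hn)
    exact hd.1 (eq_of_antitone_of_map_eq hμ hκ he.symm)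
  rw [coeff_sub, coeff_monomialSymm, if_pos (by rw [hκ']), sub_eq_zero] at h1
  exact h1

theorem cherednikSq_eq (hα : α ≠ 0) (h : IsSymmetricJack α κ P) (hκ : Antitone κ) :
    cherednikSq α P = (∑ i, spec α κ i ^ 2) • P := by
  set κ' : Fin N →₀ ℕ := Finsupp.equivFunOnFinite.symm κ
  have hκ' : (κ' : Fin N → ℕ) = κ := rfl
  obtain ⟨c, hc⟩ := h.2.1
  obtain ⟨c, hc⟩ := cherednikSq_eq_of_D₂_eq hα h.1 (h.isHomogeneous hκ) hc
  have h1 : coeff κ' P = 1 := h.coeff_eq_one hκ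
  have h0 : P ≠ 0 := by rintro rfl; simp at h1
  obtain ⟨ν, hν, hanti, hmax, rfl⟩ := exists_antitone_of_cherednikSq_eq h.1 h0 hc
  obtain ⟨μ, hμ, hd, he⟩ := h.exists_of_mem_support hκ hν
  obtain rfl := eq_of_antitone_of_map_eq hanti hμ he
  rcases hd with hd | hd
  · rw [hc, hd]
  -- A heaviest exponent strictly below `κ` would have a smaller sum of squares than `κ`, which also
  -- occurs in `P`.
  · have h2 := hmax κ' (by rw [mem_support_iff, h1]; exact one_ne_zero)
    rw [weight, weight, Prod.Lex.toLex_le_toLex, hκ'] at h2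
    have := hd.sum_sq_lt hanti
    omega

/-- The difference has the eigenvalue of `κ`, but only exponents of partitions `μ < κ`. If it were
nonzero, its heaviest exponent would give it the eigenvalue of such a `μ`. -/
theorem unique [CharZero K] (hα : ∀ q : ℚ, q ≤ 0 → α ≠ (q : K)) (hκ : Antitone κ)
    (h : IsSymmetricJack α κ P) (h' : IsSymmetricJack α κ P') : P = P' := by
  have hα0 : α ≠ 0 := by simpa using hα 0 le_rfl
  rw [← sub_eq_zero]
  by_contra h0
  have h1 : cherednikSq α (P - P') = (∑ i, spec α κ i ^ 2) • (P - P') := by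
    rw [map_sub, h.cherednikSq_eq hα0 hκ, h'.cherednikSq_eq hα0 hκ, smul_sub]
  obtain ⟨ν, hν, hanti, -, he⟩ := exists_antitone_of_cherednikSq_eq (h.1.sub h'.1) h0 h1
  have h2 := Submodule.sub_mem _ h.2.2 h'.2.2
  rw [sub_sub_sub_cancel_right] at h2
  obtain ⟨μ, hμ, hd, hm⟩ := exists_domLT_of_mem_span h2 hν
  obtain rfl := eq_of_antitone_of_map_eq hanti hμ hm
  exact hd.sum_spec_sq_ne hα hanti hκ he.symm

end IsSymmetricJack

end Uniqueness


/-! ### Existence by symmetrization -/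

section Existence

variable {N : ℕ} {K : Type*} [Field K] {α : K}

theorem rename_cherednikSq (α : K) (g : Equiv.Perm (Fin N)) (f : MvPolynomial (Fin N) K) :
    rename g (cherednikSq α f) = cherednikSq α (rename g f) := by
  rcases N with _ | n
  · obtain rfl : g = 1 := Subsingleton.elim _ _
    simp
  have hg : g ∈ Submonoid.closure
      (Set.range fun i : Fin n => Equiv.swap i.castSucc i.succ) := by
    rw [Equiv.Perm.mclosure_swap_castSucc_succ]; trivial
  induction hg using Submonoid.closure_induction generalizing f with
  | mem x hx =>
    obtain ⟨i, rfl⟩ := hx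
    exact rename_swap_cherednikSq α (by simp) f
  | one => simp
  | mul x y _ _ hx hy =>
    rw [Equiv.Perm.coe_mul, ← rename_rename, hy, hx, rename_rename]

theorem monotone_rev (η : Fin N → ℕ) : Monotone (rev η) := fun _ _ h =>
  antitone_plus η (Fin.rev_le_rev.2 h)

theorem rev_eq_comp (η : Fin N → ℕ) : rev η = plus η ∘ Fin.revPerm := rfl

/-- The exponents occurring in `E_η` if `η` is weakly increasing with decreasing rearrangement `κ`. -/
def belowRev (κ : Fin N → ℕ) (ρ : Fin N →₀ ℕ) : Set (Fin N →₀ ℕ) :=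
  {ν | SubsetDom ν κ ∧ (ν = ρ ∨ ∑ x, ν x ^ 2 < ∑ x, κ x ^ 2)}

/-- No step from an increasing `ρ` is a mere exchange, because that would move a larger entry to the
right past a smaller one. So leaving `ρ` lowers the sum of squares. -/
theorem mem_belowRev_of_lower {κ : Fin N → ℕ} {ρ : Fin N →₀ ℕ} (hρ : Monotone (⇑ρ : Fin N → ℕ))
    {g : Equiv.Perm (Fin N)} (hg : (ρ : Fin N → ℕ) = κ ∘ g) {μ ν : Fin N →₀ ℕ}
    (hμ : μ ∈ belowRev κ ρ) (h : Lower ν μ) : ν ∈ belowRev κ ρ := by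
  refine ⟨h.subsetDom.trans hμ.1, Or.inr ?_⟩
  rcases hμ.2 with rfl | h1
  · have h2 : ∑ x, μ x ^ 2 = ∑ x, κ x ^ 2 := by
      rw [hg]; exact Equiv.sum_comp g fun x => κ x ^ 2
    rcases h.sum_sq_lt_or with h3 | ⟨-, i, p, hip, hlt, -⟩
    · rwa [← h2]
    · exact absurd (hρ hip.le) hlt.not_ge
  · rcases h.sum_sq_lt_or with h3 | ⟨h3, -⟩
    · exact h3.trans h1
    · rwa [h3]

/-- The set is a coset of the stabilizer of `κ`, the product of the symmetric groups on its level
sets. -/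
theorem card_perm_comp_eq (κ : Fin N → ℕ) (g₀ : Equiv.Perm (Fin N)) :
    (Finset.univ.filter fun g : Equiv.Perm (Fin N) => κ ∘ g = κ ∘ g₀).card =
      ∏ j ∈ Finset.range (Finset.univ.sup κ + 1), (freq κ j).factorial := by
  have h1 : (Finset.univ.filter fun g : Equiv.Perm (Fin N) => κ ∘ g = κ ∘ g₀).card =
      (Finset.univ.filter fun g : Equiv.Perm (Fin N) => κ ∘ g = κ).card := by
    refine Finset.card_equiv (Equiv.mulRight g₀⁻¹) fun g => ?_
    simp only [Finset.mem_filter, Finset.mem_univ, true_and, Equiv.coe_mulRight,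
      Equiv.Perm.coe_mul, ← Function.comp_assoc]
    constructor
    · intro h
      rw [h, Function.comp_assoc, ← Equiv.Perm.coe_mul, mul_inv_cancel]; rfl
    · intro h
      have := congrArg (· ∘ (g₀ : Fin N → Fin N)) h
      simpa only [Function.comp_assoc, ← Equiv.Perm.coe_mul, inv_mul_cancel_right, Equiv.Perm.coe_one,
        Function.comp_id] using this
  rw [h1, ← Fintype.card_subtype, DomMulAct.stabilizer_card']
  have h2 : Finset.image κ Finset.univ ⊆ Finset.range (Finset.univ.sup κ + 1) := by
    intro j hj
    obtain ⟨i, -, rfl⟩ := Finset.mem_image.1 hj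
    exact Finset.mem_range.2 (lt_sup_succ κ i)
  have h3 : ∀ j, Fintype.card {a // κ a = j} = freq κ j := fun j => Fintype.card_subtype _
  simp only [h3]
  refine Finset.prod_subset h2 fun j _ hj => ?_
  have : freq κ j = 0 := by
    rw [freq, Finset.card_eq_zero, Finset.filter_eq_empty_iff]
    exact fun i _ h => hj (Finset.mem_image.2 ⟨i, Finset.mem_univ i, h⟩)
  rw [this, Nat.factorial_zero]

theorem d_ne_zero [CharZero K] (hα : ∀ q : ℚ, q ≤ 0 → α ≠ (q : K)) (η : Fin N → ℕ) :
    d α η ≠ 0 := by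
  refine Finset.prod_ne_zero_iff.2 fun i _ => Finset.prod_ne_zero_iff.2 fun j _ => ?_
  have := mul_natCast_add_natCast_ne_zero hα (arm η i j + 1) (Nat.succ_pos (leg η i j))
  push_cast at this
  rwa [add_assoc]

theorem h_ne_zero [CharZero K] (hα : ∀ q : ℚ, q ≤ 0 → α ≠ (q : K)) (η : Fin N → ℕ) :
    h α η ≠ 0 := by
  refine Finset.prod_ne_zero_iff.2 fun i _ => Finset.prod_ne_zero_iff.2 fun j _ => ?_
  have := mul_natCast_add_natCast_ne_zero hα (arm η i j) (Nat.succ_pos (leg η i j))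
  push_cast at this
  rwa [add_assoc]

/-- The symmetrization of `E_{ηᴿ}` is a multiple of `P_{η⁺}`. -/
theorem IsNonsymmetricJack.isSymmetricJack [CharZero K] (hα : ∀ q : ℚ, q ≤ 0 → α ≠ (q : K))
    {η : Fin N → ℕ} {E : MvPolynomial (Fin N) K}
    (hE : IsNonsymmetricJack α (Finsupp.equivFunOnFinite.symm (rev η)) E) :
    IsSymmetricJack α (plus η)
      ((∏ j ∈ Finset.range (Finset.univ.sup (plus η) + 1), ((freq (plus η) j).factorial : K))⁻¹ •
        ∑ g : Equiv.Perm (Fin N), rename g E) := by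
  classical
  have hα0 : α ≠ 0 := by simpa using hα 0 le_rfl
  set ρ : Fin N →₀ ℕ := Finsupp.equivFunOnFinite.symm (rev η) with hρdef
  have hρ : (ρ : Fin N → ℕ) = plus η ∘ Fin.revPerm := rfl
  have hρmono : Monotone (⇑ρ : Fin N → ℕ) := monotone_rev η
  have hκ := antitone_plus η
  set κ := plus η with hκdef
  set κ' : Fin N →₀ ℕ := Finsupp.equivFunOnFinite.symm κ
  have hκ' : (κ' : Fin N → ℕ) = κ := rfl
  set F := ∏ j ∈ Finset.range (Finset.univ.sup κ + 1), ((freq κ j).factorial : K) with hF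
  have hF0 : F ≠ 0 :=
    Finset.prod_ne_zero_iff.2 fun j _ => Nat.cast_ne_zero.2 (Nat.factorial_ne_zero _)
  set P := F⁻¹ • ∑ g : Equiv.Perm (Fin N), rename g E with hP
  have hsq : ∀ g : Equiv.Perm (Fin N), ∑ x, κ (g x) ^ 2 = ∑ x, κ x ^ 2 := fun g =>
    Equiv.sum_comp g fun x => κ x ^ 2
  have hsupp : ↑E.support ⊆ belowRev κ ρ := by
    refine support_subset_of_cherednik_eq hα hE.1
      (fun μ hμ ν hl => mem_belowRev_of_lower hρmono hρ hμ hl) ⟨?_, Or.inl rfl⟩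
    rw [hρ]
    exact subsetDom_comp_perm κ _
  have hsymm : P.IsSymmetric := by
    intro g
    rw [hP, map_smul, map_sum]
    congr 1
    simp only [rename_rename, ← Equiv.Perm.coe_mul]
    exact Equiv.sum_comp (Equiv.mulLeft g) fun g' : Equiv.Perm (Fin N) => rename g' E
  have hPsupp : ∀ ν ∈ P.support, SubsetDom ν κ := by
    intro ν hν
    rw [mem_support_iff, hP, coeff_smul, coeff_sum] at hν
    obtain ⟨g, -, hg⟩ := Finset.exists_ne_zero_of_sum_ne_zero (right_ne_zero_of_mul hν)
    rw [coeff_rename_perm] at hg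
    refine SubsetDom.trans ?_ (hsupp (mem_support_iff.2 hg)).1
    have : (ν : Fin N → ℕ) = ν.mapDomain g.symm ∘ (g.symm : Equiv.Perm (Fin N)) := by
      funext x
      rw [Function.comp, Finsupp.mapDomain_equiv_apply]; simp
    rw [this]
    exact subsetDom_comp_perm _ _
  -- All rearrangements of `κ` have the same sum of squares, so among them `E` contains only `ρ`. It
  -- is moved to `κ` by exactly `F` permutations.
  have hcoeff : coeff κ' P = 1 := by
    have h1 : ∀ g : Equiv.Perm (Fin N), coeff κ' (rename g E) =
        if κ ∘ g = κ ∘ Fin.revPerm then 1 else 0 := by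
      intro g
      have hg : (κ'.mapDomain g.symm : Fin N → ℕ) = κ ∘ g := by
        funext x
        rw [Finsupp.mapDomain_equiv_apply, Equiv.symm_symm, hκ', Function.comp]
      rw [coeff_rename_perm]
      split_ifs with h
      · rw [← hE.2]
        congr 1
        exact DFunLike.coe_injective (hg.trans h)
      · by_contra hn
        rcases (hsupp (mem_support_iff.2 hn)).2 with h2 | h2
        · exact h (by rw [← hg, h2, hρ])
        · rw [hg] at h2
          exact absurd h2 (hsq g).not_lt
    rw [hP, coeff_smul, coeff_sum, Finset.sum_congr rfl fun g _ => h1 g, Finset.sum_boole,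
      card_perm_comp_eq, Nat.cast_prod, smul_eq_mul, inv_mul_cancel₀ hF0]
  have hhom : P.IsHomogeneous (∑ i, κ i) := isHomogeneous_of_sum_eq fun ν hν => (hPsupp ν hν).1
  have hcher : cherednikSq α P = (∑ i, spec α ρ i ^ 2) • P := by
    have h1 : cherednikSq α E = (∑ i, spec α ρ i ^ 2) • E := by
      rw [cherednikSq_apply, Finset.sum_smul]
      refine Finset.sum_congr rfl fun i _ => ?_
      rw [hE.1, map_smul, hE.1, smul_smul, sq]
    have h2 : cherednikSq α (∑ g : Equiv.Perm (Fin N), rename g E) =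
        (∑ i, spec α ρ i ^ 2) • ∑ g : Equiv.Perm (Fin N), rename g E := by
      rw [map_sum, Finset.smul_sum]
      refine Finset.sum_congr rfl fun g _ => ?_
      rw [← rename_cherednikSq, h1, map_smul]
    rw [hP, map_smul, h2, smul_comm]
  refine ⟨hsymm, D₂_eq_of_cherednikSq_eq hα0 hsymm hhom hcher, ?_⟩
  have hQ : (P - monomialSymm K κ).IsSymmetric := hsymm.sub (isSymmetric_monomialSymm κ)
  rw [isSymmetric_eq_sum hQ]
  refine Submodule.sum_mem _ fun μ hμ => Submodule.smul_mem _ _ (Submodule.subset_span ?_)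
  obtain ⟨hμs, hμa⟩ := Finset.mem_filter.1 hμ
  have hne : (μ : Fin N → ℕ) ≠ κ := by
    intro he
    have : μ = κ' := DFunLike.coe_injective he
    rw [this, mem_support_iff, coeff_sub, hcoeff, coeff_monomialSymm, if_pos (by rw [hκ']),
      sub_self] at hμs
    exact hμs rfl
  refine ⟨μ, hμa, (hPsupp μ ?_).domLT hκ hne, rfl⟩
  rw [mem_support_iff, coeff_sub, coeff_monomialSymm, if_neg, sub_zero] at hμs
  · exact mem_support_iff.2 hμs
  · exact fun he => hne (eq_of_antitone_of_map_eq hμa hκ he)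

theorem factorial_div_mul_eq [CharZero K] (hα : ∀ q : ℚ, q ≤ 0 → α ≠ (q : K)) (η : Fin N → ℕ) :
    (N.factorial : K) / (∏ j ∈ Finset.range (Finset.univ.sup (plus η) + 1),
      ((freq (plus η) j).factorial : K)) * (e α (rev η) / d α (rev η)) =
        b α (plus η) / h α (plus η) := by
  have hF0 : ∏ j ∈ Finset.range (Finset.univ.sup (plus η) + 1),
      ((freq (plus η) j).factorial : K) ≠ 0 :=
    Finset.prod_ne_zero_iff.2 fun j _ => Nat.cast_ne_zero.2 (Nat.factorial_ne_zero _)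
  rw [div_mul_div_comm, div_eq_div_iff (mul_ne_zero hF0 (d_ne_zero hα _)) (h_ne_zero hα _),
    ← h_mul_prod, rev_eq_comp, e_comp_perm, factorial_mul_e α (antitone_plus η)]
  ring

end Existence

end Jack

/-! ### The evaluation formula -/

theorem proposition3p3 {K : Type*} [Field K] [CharZero K] (α : K)
    (hα : ∀ q : ℚ, q ≤ 0 → α ≠ (q : K)) (N : ℕ) (η : Fin N → ℕ) :
    (∃! P : MvPolynomial (Fin N) K, Jack.IsSymmetricJack α (Jack.plus η) P) ∧
    ∀ P : MvPolynomial (Fin N) K, Jack.IsSymmetricJack α (Jack.plus η) P →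
      MvPolynomial.eval (fun _ => (1 : K)) P =
          (N.factorial : K) /
              (∏ j ∈ Finset.range (Finset.univ.sup (Jack.plus η) + 1),
                ((Jack.freq (Jack.plus η) j).factorial : K)) *
            (Jack.e α (Jack.rev η) / Jack.d α (Jack.rev η)) ∧
      (N.factorial : K) /
              (∏ j ∈ Finset.range (Finset.univ.sup (Jack.plus η) + 1),
                ((Jack.freq (Jack.plus η) j).factorial : K)) *
            (Jack.e α (Jack.rev η) / Jack.d α (Jack.rev η)) =
          Jack.b α (Jack.plus η) / Jack.h α (Jack.plus η) := by
  have hκ := Jack.antitone_plus η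
  obtain ⟨E, hE, hev⟩ := Jack.exists_isNonsymmetricJack hα
    (Finsupp.equivFunOnFinite.symm (Jack.rev η))
  have hP := hE.isSymmetricJack hα
  refine ⟨⟨_, hP, fun P h => h.unique hα hκ hP⟩,
    fun P h => ⟨?_, Jack.factorial_div_mul_eq hα η⟩⟩
  have hd : MvPolynomial.eval (fun _ => (1 : K)) E = Jack.e α (Jack.rev η) / Jack.d α (Jack.rev η) :=
    (eq_div_iff (Jack.d_ne_zero hα _)).2 hev
  -- By uniqueness `P` is the normalized symmetrization, whose `N!` summands all take the value of
  -- `E` at `(1, …, 1)`.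
  rw [h.unique hα hκ hP, MvPolynomial.smul_eval, map_sum]
  simp only [Jack.eval_one_rename]
  rw [hd, Finset.sum_const, Finset.card_univ, Fintype.card_perm, Fintype.card_fin, nsmul_eq_mul]
  ring
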